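/- Let $n\ge 0$ be an integer, let $\mathbb Z[t]=\mathbb Z[t_1,\dots,t_n]=H^*(BT)$ (with $\deg t_i=2$) be the cohomology ring of the classifying space of an $n$-dimensional torus $T$, and put the inner product on $H^2(BT)=\bigoplus_i\mathbb Z t_i$ for which $t_1,\dots,t_n$ is orthonormal. Let $\Phi(D_n)=\{\pm(t_i+t_j),\ \pm(t_i-t_j)\mid 1\le i<j\le n\}$. A signed permutation $w$ of $\{\pm1,\dots,\pm n\}$ (with $w(-i)=-w(i)$) acts on $H^2(BT)$ by $t_i\mapsto t_{w(i)}$, where $t_{-m}:=-t_m$. Let $\mathcal D_n$ (resp. $\mathcal D_n^-$) be the labeled graph whose vertices are the signed permutations $w$ for which the number of $i\in\{1,\dots,n\}$ with $w(i)<0$ is even (resp. odd), in which $w$ and $w'$ are joined by an edge if and only if $w'=w\sigma_\alpha$ for some $\alpha\in\Phi(D_n)$, where $\sigma_\alpha$ is the reflection in $\alpha$; this edge is labeled by $w\alpha$ (well defined up to sign). For such a graph $\mathcal G$ with vertex set $V$, the graph cohomology ring $H_T^*(\mathcal G)$ is the graded subring of all $h\in \mathrm{Map}(V,\mathbb Z[t])$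 such that $h(w)-h(w')$ is divisible in $\mathbb Z[t]$ by the label of the edge whenever $w$ and $w'$ are joined by an edge. Define elements $\tau_i,t_i$ $(1\le i\le n)$ and $f_i$ $(1\le i\le n-1)$ of $H_T^*(\mathcal G)$ by $$\tau_i(w)=t_{w(i)},\qquad t_i(w)=t_i,\qquad f_i=\tfrac12\bigl(e_i(\tau)-e_i(t)\bigr),$$ where $e_i(\tau)$ and $e_i(t)$ are the $i$-th elementary symmetric polynomials in $\tau_1,\dots,\tau_n$ and in $t_1,\dots,t_n$. **Theorem.** (1) These elements generate $H_T^*(\mathcal D_n)$ as a ring, and the ideal of relations among them is $I$; that is, there is an isomorphism of graded rings ($\deg\tau_i=\deg t_i=2$, $\deg f_i=2i$) $$\mathbb Z[\tau_1,\dots,\tau_n,t_1,\dots,t_n,f_1,\dots,f_{n-1}]/I\;\cong\; H_T^*(\mathcal D_n)$$ which sends each generator to the element of the same name, where $I$ is the ideal generated by $$2f_i-e_i(\tau)+e_i(t)\quad(1\le i\le n-1),$$ $$\sum_{j=1}^{2k}(-1)^jf_j\bigl(f_{2k-j}+e_{2k-j}(t)\bigr)\quad(1\le k\le n),$$ $$e_n(\tau)-e_n(t),$$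 with $e_0=1$, $f_0=0$, $f_\ell=0$ for $\ell\ge n$ and $e_\ell(t)=0$ for $\ell>n$. (2) If $n\ge1$, the same holds for $\mathcal D_n^-$ with $I$ replaced by the ideal $I^-$ given by the same generators, except that the last one is replaced by $e_n(\tau)+e_n(t)$ and that in the quadratic relations $f_n$ stands for $-e_n(t)$ instead of $0$ (with $f_0=0$ and $f_\ell=0$ for $\ell>n$). -/

import Mathlib

namespace GKM

noncomputable section

/-! ### Labeled graphs and their graph cohomology -/

/-- `H²(BT)` for a torus `T` of dimension `n`, as the free abelian group on `t_1, …, t_n`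
(indexed by `Fin n`), with the inner product `⬝ᵥ` for which this basis is orthonormal. -/
abbrev H2 (n : ℕ) : Type := Fin n → ℤ

/-- `H^*(BT) = ℤ[t_1, …, t_n]`. -/
abbrev HBT (n : ℕ) : Type := MvPolynomial (Fin n) ℤ

/-- The basis element `t_i` of `H²(BT)`. -/
def tBasis {n : ℕ} (i : Fin n) : H2 n := Pi.single i 1

/-- The inclusion `H²(BT) ⊆ H^*(BT)` (linear forms). -/
def H2.toHBT {n : ℕ} (a : H2 n) : HBT n := ∑ i, MvPolynomial.C (a i) * MvPolynomial.X i

/-- A graph with edges labeled by elements of `H²(BT)`. `IsEdge v v' a` says that `v` and `v'`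
are connected by an edge which carries the label `a`. A label that is only defined up to sign is
recorded with both signs, which does not affect the graph cohomology. -/
structure LabeledGraph (n : ℕ) where
  /-- The vertices. -/
  V : Type
  /-- The labeled edges. -/
  IsEdge : V → V → H2 n → Prop

/-- The graph cohomology ring: maps `h : V → H^*(BT)` such that `h v - h v'` is divisible by the
label of each edge between `v` and `v'`. -/
def LabeledGraph.cohomology {n : ℕ} (G : LabeledGraph n) : Subring (G.V → HBT n) where
  carrier := {h | ∀ v v' a, G.IsEdge v v' a → a.toHBT ∣ h v - h v'}
  zero_mem' := by
    intro v v' a _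
    simp
  one_mem' := by
    intro v v' a _
    simp
  add_mem' := by
    intro h k hh hk v v' a e
    have := dvd_add (hh v v' a e) (hk v v' a e)
    rwa [show (h + k) v - (h + k) v' = h v - h v' + (k v - k v') by
      simp only [Pi.add_apply]; ring]
  mul_mem' := by
    intro h k hh hk v v' a e
    have := dvd_add (Dvd.dvd.mul_left (hk v v' a e) (h v))
      (Dvd.dvd.mul_left (hh v v' a e) (k v'))
    rwa [show (h * k) v - (h * k) v' = h v * (k v - k v') + k v' * (h v - h v') by
      simp only [Pi.mul_apply]; ring]
  neg_mem' := by
    intro h hh v v' a e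
    have := (dvd_neg (a := a.toHBT)).mpr (hh v v' a e)
    rwa [show (-h) v - (-h) v' = -(h v - h v') by simp only [Pi.neg_apply]; ring]

/-! ### Signed permutations and the graphs of type `D` -/

/-- A signed permutation `w` of `±[n]` (so `w (-i) = - w i`), given by its one-line notation
`w(i) = sign i · perm i`. -/
@[ext]
structure SignedPerm (n : ℕ) where
  /-- `i ↦ |w(i)|`. -/
  perm : Equiv.Perm (Fin n)
  /-- `i ↦` the sign of `w(i)`. -/
  sign : Fin n → ℤˣ

/-- The element `t_{w(i)}` of `H²(BT)`, where `t_{-m} = -t_m`. -/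
def SignedPerm.tAt {n : ℕ} (w : SignedPerm n) (i : Fin n) : H2 n :=
  Pi.single (w.perm i) (w.sign i : ℤ)

/-- The linear action of `w` on `H²(BT)`, determined by `t_i ↦ t_{w(i)}`. -/
def SignedPerm.act {n : ℕ} (w : SignedPerm n) (x : H2 n) : H2 n := ∑ i, x i • w.tAt i

/-- The number of `i ∈ [n]` with `w(i) < 0`. -/
def SignedPerm.negCount {n : ℕ} (w : SignedPerm n) : ℕ :=
  (Finset.univ.filter fun i => w.sign i = -1).card

/-- The reflection `x ↦ x - 2 (x, a) / (a, a) a`. (For a root `a` of a root system in `H²(BT)` the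
integer division is exact; for a root of type `D` one has `(a, a) = 2`.) -/
def reflection {n : ℕ} (a x : H2 n) : H2 n := x - (2 * (x ⬝ᵥ a) / (a ⬝ᵥ a)) • a

/-- The root system `Φ(D_n) = {±(t_i + t_j), ±(t_i - t_j) | i < j}`. -/
def rootsD (n : ℕ) : Set (H2 n) :=
  {a | ∃ i j : Fin n, i < j ∧
    (a = tBasis i + tBasis j ∨ a = -(tBasis i + tBasis j) ∨
      a = tBasis i - tBasis j ∨ a = -(tBasis i - tBasis j))}

/-- The labeled graph with a given set `V` of signed permutations as vertices, in which `w` and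
`w'` are connected by an edge iff `w' = w σ_a` for some `a ∈ Φ`, and this edge is labeled by
`w a`. -/
def rootGraph {n : ℕ} (Φ : Set (H2 n)) (V : Set (SignedPerm n)) : LabeledGraph n where
  V := V
  IsEdge w w' b := ∃ a ∈ Φ, (∀ x, w'.1.act x = w.1.act (reflection a x)) ∧ b = w.1.act a

/-- The vertices of `D_n`: the Weyl group of `Φ(D_n)`, i.e. the signed permutations with an even
number of negative values. -/
def evenSigned (n : ℕ) : Set (SignedPerm n) := {w | Even w.negCount}

/-- The vertices of `D_n^-`: the signed permutations with an odd number of negative values. -/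
def oddSigned (n : ℕ) : Set (SignedPerm n) := {w | Odd w.negCount}

/-- The labeled graph `D_n` associated with the root system `Φ(D_n)`. -/
def graphD (n : ℕ) : LabeledGraph n := rootGraph (rootsD n) (evenSigned n)

/-- The companion labeled graph `D_n^-`. -/
def graphDMinus (n : ℕ) : LabeledGraph n := rootGraph (rootsD n) (oddSigned n)

/-! ### The polynomial ring `ℤ[τ, t, f]` and the ideals of relations -/

/-- The generators `τ_1, …, τ_n`, `t_1, …, t_n`, `f_1, …, f_{n-1}`. -/
inductive Gen (n : ℕ) : Type
  | tau (i : Fin n) : Gen n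
  | t (i : Fin n) : Gen n
  | f (l : ℕ) (pos : 0 < l) (lt : l < n) : Gen n

/-- The polynomial ring `ℤ[τ_1, …, τ_n, t_1, …, t_n, f_1, …, f_{n-1}]`. -/
abbrev Poly (n : ℕ) : Type := MvPolynomial (Gen n) ℤ

/-- The (cohomological) degrees of the generators: `2` for `τ_i` and `t_i`, and `2 l` for `f_l`. -/
def Gen.degree {n : ℕ} : Gen n → ℕ
  | tau _ => 2
  | t _ => 2
  | f l _ _ => 2 * l

/-- The elementary symmetric polynomial `e_l(τ)`; it is `1` for `l = 0` and `0` for `l > n`. -/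
def eTau (n l : ℕ) : Poly n := MvPolynomial.rename Gen.tau (MvPolynomial.esymm (Fin n) ℤ l)

/-- The elementary symmetric polynomial `e_l(t)`; it is `1` for `l = 0` and `0` for `l > n`. -/
def eT (n l : ℕ) : Poly n := MvPolynomial.rename Gen.t (MvPolynomial.esymm (Fin n) ℤ l)

/-- `f_l`, with `f_0 = 0` and `f_l = 0` for `l ≥ n`. -/
def fD (n l : ℕ) : Poly n :=
  if h : 0 < l ∧ l < n then MvPolynomial.X (Gen.f l h.1 h.2) else 0

/-- `f_l` in the case of `D_n^-`: here `f_n = -e_n(t)`, while `f_0 = 0` and `f_l = 0` for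
`l > n`. (Used for `n ≥ 1` only.) -/
def fDMinus (n l : ℕ) : Poly n := if l = n then -eT n n else fD n l

/-- `∑_{j=1}^{2k} (-1)^j f_j (f_{2k-j} + e_{2k-j}(t))`. -/
def quadRel {n : ℕ} (F : ℕ → Poly n) (k : ℕ) : Poly n :=
  ∑ j ∈ Finset.Icc 1 (2 * k), (-1) ^ j * F j * (F (2 * k - j) + eT n (2 * k - j))

/-- The ideal of relations for `D_n`. -/
def idealD (n : ℕ) : Ideal (Poly n) :=
  Ideal.span
    ({p | ∃ i, 1 ≤ i ∧ i < n ∧ p = 2 * fD n i - eTau n i + eT n i} ∪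
      {p | ∃ k, 1 ≤ k ∧ k ≤ n ∧ p = quadRel (fD n) k} ∪
      {eTau n n - eT n n})

/-- The ideal of relations for `D_n^-`. -/
def idealDMinus (n : ℕ) : Ideal (Poly n) :=
  Ideal.span
    ({p | ∃ i, 1 ≤ i ∧ i < n ∧ p = 2 * fDMinus n i - eTau n i + eT n i} ∪
      {p | ∃ k, 1 ≤ k ∧ k ≤ n ∧ p = quadRel (fDMinus n) k} ∪
      {eTau n n + eT n n})

end

end GKM

namespace GKM
/-! ### Freeness and local interpolation -/

section Interpolation

variable {R : Type*} [CommRing R] {V : Type*} [Fintype V] [DecidableEq V]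

/-! Write R = ℤ[t], let V be the vertex set, and let A be the quotient of ℤ[τ, t, f] by the
relations. Both graphs are treated at once, with a sign δ such that e_n(τ) = δ e_n(t).

Upper bound: the quadratic relations rewrite every f_k², so products of distinct f's span R[f],
which needs at most 2^(n-1) generators. The remaining relations put all e_l(τ) into R[f], so the τ_i
are roots of a monic polynomial over R[f], and adjoining them costs a factor n!. Hence A is
generated over R by |V| elements (`exists_generators`, `le_card_of_prod_sign`).

The evaluation map A → R^V is then given by a square matrix M. Its image has full rank, so det M ≠ 0
and the map is injective: no further relations are needed. By Cramer's rule, h lies in the image iff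
det M divides h · adj M. In the UFD R this can be tested at one prime π at a time, after multiplying
h by some s prime to π (`injective_and_mem_range_of_local`).

At a prime associated to no root, the generators separate all vertices, so every function is locally
in the image. The prime 2 is where the f's are indispensable: the τ_i alone do not see signs there,
but f_1 does (`exists_not_dvd_evalGen_sub`). At a root, only the pairs joined by the corresponding
reflection fail to be separated, and divisibility along those edges is exactly what interpolation
requires (`exists_smul_mem_of_paired`). -/

theorem dvd_of_forall_prime_dvd_mul [IsDomain R] [UniqueFactorizationMonoid R] {d x : R}
    (hd : d ≠ 0) (h : ∀ π : R, Prime π → ∃ s, ¬ π ∣ s ∧ d ∣ s * x) : d ∣ x := by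
  obtain ⟨d', x', g, hrel, rfl, rfl⟩ := UniqueFactorizationMonoid.exists_reduced_factors d hd x
  have hg : g ≠ 0 := left_ne_zero_of_mul hd
  have hd' : d' ≠ 0 := right_ne_zero_of_mul hd
  have key : ∀ s, g * d' ∣ s * (g * x') → d' ∣ s := by
    intro s hs
    rw [mul_left_comm, mul_dvd_mul_iff_left hg] at hs
    refine UniqueFactorizationMonoid.dvd_of_dvd_mul_left_of_no_prime_factors hd' ?_
      (by rwa [mul_comm] at hs)
    intro p hp hpx hprime
    exact hprime.not_isUnit (hrel hp hpx)
  -- Here d' is d divided by its common part with x; a prime factor of d' would have to divide the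
  -- multiplier s chosen for that very prime.
  have hu : IsUnit d' := by
    by_contra hu
    obtain ⟨p, hp, hpd⟩ := WfDvdMonoid.exists_irreducible_factor hu hd'
    obtain ⟨s, hs, hs'⟩ := h p hp.prime
    exact hs (hpd.trans (key s hs'))
  exact mul_dvd_mul_left g hu.dvd

/-- A linear map to `V → R` from a module generated by `|V|` elements is injective if its image has
full rank, and then its image is determined by its localizations at the primes of the unique
factorization domain `R`. -/
theorem injective_and_mem_range_of_local [IsDomain R] [UniqueFactorizationMonoid R]
    {A : Type*} [AddCommGroup A] [Module R A] (Φ : A →ₗ[R] (V → R)) (b : V → A)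
    (hb : Submodule.span R (Set.range b) = ⊤)
    (hrank : ∀ w, ∃ a, ∃ d, d ≠ 0 ∧ Φ a = Pi.single w d) :
    Function.Injective Φ ∧
      ∀ h : V → R, (∀ π : R, Prime π → ∃ s, ¬ π ∣ s ∧ s • h ∈ LinearMap.range Φ) →
        h ∈ LinearMap.range Φ := by
  classical
  have hcomb : ∀ a, ∃ c : V → R, a = ∑ v, c v • b v := by
    intro a
    have : a ∈ Submodule.span R (Set.range b) := hb ▸ Submodule.mem_top
    obtain ⟨c, hc⟩ := (Submodule.mem_span_range_iff_exists_fun R).1 this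
    exact ⟨c, hc.symm⟩
  let M : Matrix V V R := Matrix.of fun v w => Φ (b v) w
  have hΦ : ∀ c : V → R, Φ (∑ v, c v • b v) = Matrix.vecMul c M := by
    intro c
    ext w
    simp [Matrix.vecMul, dotProduct, M]
  -- Expressing the preimages of the multiples of unit vectors through the generators gives a left
  -- factor of M whose product with M is diagonal with nonzero entries.
  have hdet : M.det ≠ 0 := by
    choose a d hd ha using hrank
    choose c hc using fun w => hcomb (a w)
    have hCM : Matrix.of c * M = Matrix.diagonal d := by
      ext w v
      have := congrFun ((ha w).symm.trans ((congrArg Φ (hc w)).trans (hΦ (c w)))) v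
      rw [Matrix.diagonal_apply]
      rw [Pi.single_apply] at this
      simp only [eq_comm (a := v)] at this
      rw [this]
      rfl
    have h1 : (Matrix.of c).det * M.det = ∏ w, d w := by
      rw [← Matrix.det_mul, hCM, Matrix.det_diagonal]
    intro h0
    rw [h0, mul_zero] at h1
    exact Finset.prod_ne_zero_iff.2 (fun w _ => hd w) h1.symm
  have hinj : ∀ c : V → R, Matrix.vecMul c M = 0 → c = 0 := fun c hc =>
    Matrix.eq_zero_of_vecMul_eq_zero hdet hc
  refine ⟨?_, ?_⟩
  · rw [injective_iff_map_eq_zero]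
    intro a ha
    obtain ⟨c, rfl⟩ := hcomb a
    rw [hΦ] at ha
    simp [hinj c ha]
  · intro h hloc
    -- Cramer's rule: membership of h in the image becomes divisibility of h · adj M by det M, a
    -- condition that is local at primes.
    have hadj : Matrix.vecMul (Matrix.vecMul h M.adjugate) M = M.det • h := by
      rw [Matrix.vecMul_vecMul, Matrix.adjugate_mul, Matrix.vecMul_smul, Matrix.vecMul_one]
    have hdvd : ∀ v, M.det ∣ Matrix.vecMul h M.adjugate v := by
      intro v
      refine dvd_of_forall_prime_dvd_mul hdet ?_
      intro π hπ
      obtain ⟨s, hs, a, ha⟩ := hloc π hπ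
      refine ⟨s, hs, ?_⟩
      obtain ⟨c, rfl⟩ := hcomb a
      rw [hΦ] at ha
      have : s • Matrix.vecMul h M.adjugate - M.det • c = 0 := by
        apply hinj
        rw [Matrix.sub_vecMul, Matrix.smul_vecMul, Matrix.smul_vecMul, hadj, ha, smul_comm,
          sub_self]
      have := congrFun (sub_eq_zero.1 this) v
      simp only [Pi.smul_apply, smul_eq_mul] at this
      exact ⟨c v, this⟩
    choose c hc using hdvd
    refine ⟨∑ v, c v • b v, ?_⟩
    rw [hΦ]
    have h2 : M.det • (Matrix.vecMul c M - h) = 0 := by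
      rw [smul_sub, ← Matrix.smul_vecMul, ← hadj, sub_eq_zero]
      congr 1
      ext v
      exact (hc v).symm
    exact sub_eq_zero.1 ((smul_eq_zero.1 h2).resolve_left hdet)

/-! ### Interpolation at a single prime. -/

variable {L : Subalgebra R (V → R)} {π : R}

/-- If functions in `L` separate `w` from the complement of `E` modulo a prime, some function in `L`
vanishes outside `E` and is nonzero at `w` modulo the prime. -/
theorem exists_mem_eq_zero_off (hπ : Prime π) (w : V) (E : Finset V)
    (hsep : ∀ w', w' ∉ E → ∃ u ∈ L, ¬ π ∣ u w - u w') :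
    ∃ g ∈ L, (∀ v, v ∉ E → g v = 0) ∧ ¬ π ∣ g w := by
  choose u huL hu using hsep
  -- One factor for each point outside E, vanishing at that point and nonzero modulo π at w.
  let k : V → V → R := fun w' => if h : w' ∈ E then 1 else u w' h - algebraMap R (V → R) (u w' h w')
  refine ⟨∏ w', k w', L.prod_mem fun w' _ => ?_, fun v hv => ?_, ?_⟩
  · by_cases h : w' ∈ E
    · simp only [k, h, dif_pos]
      exact L.one_mem
    · simp only [k, h, dif_neg, not_false_eq_true]
      exact L.sub_mem (huL w' h) (L.algebraMap_mem _)
  · rw [Finset.prod_apply]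
    refine Finset.prod_eq_zero (Finset.mem_univ v) ?_
    simp [k, hv]
  · rw [Finset.prod_apply, hπ.dvd_finsetProd_iff]
    rintro ⟨w', _, hw'⟩
    by_cases h : w' ∈ E
    · simp only [k, h, dif_pos, Pi.one_apply] at hw'
      exact hπ.not_isUnit (isUnit_of_dvd_one hw')
    · simp only [k, h, dif_neg, not_false_eq_true, Pi.sub_apply] at hw'
      exact hu w' h hw'

theorem exists_single_mem (hπ : Prime π)
    (hsep : ∀ w w', w ≠ w' → ∃ u ∈ L, ¬ π ∣ u w - u w') (w : V) :
    ∃ s, ¬ π ∣ s ∧ Pi.single w s ∈ L := by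
  obtain ⟨g, hgL, hg0, hgw⟩ := exists_mem_eq_zero_off hπ w {w} (fun w' hw' =>
    hsep w w' (by simpa [eq_comm] using hw'))
  refine ⟨g w, hgw, ?_⟩
  convert hgL using 1
  ext v
  by_cases h : v = w
  · subst h; simp
  · simp [h, hg0 v (by simpa using h)]

theorem exists_smul_mem_of_separated (hπ : Prime π)
    (hsep : ∀ w w', w ≠ w' → ∃ u ∈ L, ¬ π ∣ u w - u w') (h : V → R) :
    ∃ s, ¬ π ∣ s ∧ s • h ∈ L := by
  choose s hs hsL using exists_single_mem hπ hsep
  refine ⟨∏ w, s w, ?_, ?_⟩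
  · rw [hπ.dvd_finsetProd_iff]
    rintro ⟨w, _, hw⟩
    exact hs w hw
  · have : (∏ w, s w) • h =
        ∑ w, ((∏ w' ∈ Finset.univ.erase w, s w') * h w) • (Pi.single w (s w) : V → R) := by
      ext v
      rw [Finset.sum_apply, Finset.sum_eq_single v]
      · simp only [Pi.smul_apply, smul_eq_mul, Pi.single_eq_same]
        rw [← Finset.mul_prod_erase _ _ (Finset.mem_univ v)]
        ring
      · intro w _ hw
        simp [hw.symm]
      · simp
    rw [this]
    exact L.sum_mem fun w _ => L.smul_mem (hsL w) _

/-- The case of a root π: σ is the reflection, and congruence modulo π across each pair is the only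
local constraint. On one pair, a function u jumping by exactly π allows affine interpolation of h; a
function supported on the pair then removes the other points. -/
theorem exists_smul_mem_of_paired (hπ : Prime π) (h2 : ¬ π ∣ 2) (σ : Equiv.Perm V)
    (hσσ : ∀ w, σ (σ w) = w) (hσ : ∀ w, σ w ≠ w)
    (hsep : ∀ w w', w' ≠ w → w' ≠ σ w → ∃ u ∈ L, ¬ π ∣ u w - u w')
    (hL : ∀ u ∈ L, ∀ w, π ∣ u w - u (σ w))
    (htan : ∀ w, ∃ u ∈ L, u w - u (σ w) = π)
    (h : V → R) (hh : ∀ w, π ∣ h w - h (σ w)) :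
    ∃ s, ¬ π ∣ s ∧ s • h ∈ L := by
  have key : ∀ w, ∃ s, ¬ π ∣ s ∧
      Pi.single w (s * h w) + Pi.single (σ w) (s * h (σ w)) ∈ L := by
    intro w
    obtain ⟨g, hgL, hg0, hgw⟩ := exists_mem_eq_zero_off hπ w {w, σ w} (fun w' hw' =>
      hsep w w' (by simp at hw'; tauto) (by simp at hw'; tauto))
    obtain ⟨u, huL, hu⟩ := htan w
    obtain ⟨k, hk⟩ := hh w
    have hgσ : ¬ π ∣ g (σ w) := fun h' => hgw ((dvd_sub_left h').1 (hL g hgL w))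
    refine ⟨g w * g (σ w), hπ.not_dvd_mul hgw hgσ, ?_⟩
    -- The first two factors multiply to g(w) g(σ w) at both points of the pair and to 0 elsewhere;
    -- the last takes the values h(w) and h(σ w).
    have hmem : g * (algebraMap R (V → R) (g w + g (σ w)) - g) *
        (algebraMap R (V → R) (h (σ w)) + k • (u - algebraMap R (V → R) (u (σ w)))) ∈ L :=
      L.mul_mem (L.mul_mem hgL (L.sub_mem (L.algebraMap_mem _) hgL))
        (L.add_mem (L.algebraMap_mem _) (L.smul_mem (L.sub_mem huL (L.algebraMap_mem _)) _))
    convert hmem using 1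
    ext v
    by_cases hv : v = w
    · subst hv
      simp only [Pi.add_apply, Pi.single_eq_same, Pi.mul_apply, Pi.sub_apply, Pi.smul_apply,
        Pi.algebraMap_apply, Algebra.algebraMap_self, RingHom.id_apply, smul_eq_mul,
        Pi.single_eq_of_ne (hσ v).symm, hu]
      linear_combination g v * g (σ v) * hk
    · by_cases hv' : v = σ w
      · subst hv'
        simp only [Pi.add_apply, Pi.single_eq_same, Pi.mul_apply, Pi.sub_apply, Pi.smul_apply,
          Pi.algebraMap_apply, Algebra.algebraMap_self, RingHom.id_apply, smul_eq_mul,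
          Pi.single_eq_of_ne hv]
        ring
      · simp [hv, hv', hg0 v (by simp [hv, hv'])]
  choose s hs hsL using key
  -- The factor 2 appears because summing over all w counts every pair twice.
  refine ⟨2 * ∏ w, s w, hπ.not_dvd_mul h2 ?_, ?_⟩
  · rw [hπ.dvd_finsetProd_iff]
    rintro ⟨w, _, hw⟩
    exact hs w hw
  · have : (2 * ∏ w, s w) • h = ∑ w, (∏ w' ∈ Finset.univ.erase w, s w') •
        (Pi.single w (s w * h w) + Pi.single (σ w) (s w * h (σ w)) : V → R) := by
      ext v
      simp only [smul_add, Finset.sum_add_distrib]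
      rw [Pi.add_apply, Finset.sum_apply, Finset.sum_apply, Finset.sum_eq_single v,
        Finset.sum_eq_single (σ v)]
      · simp only [Pi.smul_apply, smul_eq_mul, Pi.single_eq_same, hσσ]
        have e1 := Finset.mul_prod_erase Finset.univ s (Finset.mem_univ v)
        have e2 := Finset.mul_prod_erase Finset.univ s (Finset.mem_univ (σ v))
        linear_combination - h v * e1 - h v * e2
      · intro w _ hw
        have : v ≠ σ w := fun e => hw (by rw [e, hσσ])
        simp [this]
      · simp
      · intro w _ hw
        simp [hw.symm]
      · simp
    rw [this]
    exact L.sum_mem fun w _ => L.smul_mem (hsL w) _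

end Interpolation

end GKM

namespace GKM

/-! ### Module generators -/

section Generators

variable {R C : Type*} [CommRing R] [CommRing C] [Algebra R C]

open scoped Pointwise in
theorem coe_image_mul_product [DecidableEq C] (P T : Finset C) :
    (((P ×ˢ T).image fun y => y.1 * y.2 : Finset C) : Set C) = (P : Set C) * (T : Set C) := by
  ext y
  simp only [Finset.coe_image, Set.mem_image, Finset.mem_coe, Finset.mem_product,
    Prod.exists, Set.mem_mul]
  constructor
  · rintro ⟨a, b, ⟨h1, h2⟩, rfl⟩
    exact ⟨a, h1, b, h2, rfl⟩
  · rintro ⟨a, h1, b, h2, rfl⟩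
    exact ⟨a, b, ⟨h1, h2⟩, rfl⟩

theorem toSubmodule_adjoin_le {S : Set C} {M : Submodule R C} (h1 : 1 ∈ M)
    (hS : ∀ s ∈ S, ∀ m ∈ M, s * m ∈ M) : Subalgebra.toSubmodule (Algebra.adjoin R S) ≤ M := by
  intro x hx
  have : ∀ m ∈ M, x * m ∈ M := by
    refine Algebra.adjoin_induction (p := fun x _ => ∀ m ∈ M, x * m ∈ M) hS ?_ ?_ ?_ hx
    · intro r m hm
      rw [← Algebra.smul_def]
      exact M.smul_mem r hm
    · intro x y _ _ hx hy m hm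
      rw [add_mul]
      exact M.add_mem (hx m hm) (hy m hm)
    · intro x y _ _ hx hy m hm
      rw [mul_assoc]
      exact hx _ (hy m hm)
  simpa using this 1 h1

theorem mul_mem_toSubmodule_mul {B : Subalgebra R C} {N : Submodule R C} {b m : C} (hb : b ∈ B)
    (hm : m ∈ Subalgebra.toSubmodule B * N) : b * m ∈ Subalgebra.toSubmodule B * N := by
  have : b * m ∈ Subalgebra.toSubmodule B * (Subalgebra.toSubmodule B * N) :=
    Submodule.mul_mem_mul hb hm
  rwa [← mul_assoc, Subalgebra.mul_toSubmodule, sup_idem] at this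

open Polynomial in
/-- Adjoining a root of a monic polynomial of degree `N` with coefficients in `B`. -/
theorem adjoin_root_le [DecidableEq C] (B : Subalgebra R C) (x : C) (p : C[X]) (hp : p.Monic)
    (hB : ∀ k, p.coeff k ∈ B) (hx : p.eval x = 0) :
    Subalgebra.toSubmodule (B ⊔ Algebra.adjoin R {x}) ≤
      Subalgebra.toSubmodule B *
        Submodule.span R ((Finset.range p.natDegree).image fun i => x ^ i : Finset C) := by
  set N := p.natDegree with hN
  set M := Subalgebra.toSubmodule B *
        Submodule.span R ((Finset.range N).image fun i => x ^ i : Finset C) with hM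
  have hpow : ∀ i < N, ∀ b ∈ B, b * x ^ i ∈ M := fun i hi b hb =>
    Submodule.mul_mem_mul hb (Submodule.subset_span (by
      simp only [Finset.coe_image, Finset.coe_range, Set.mem_image, Set.mem_Iio]
      exact ⟨i, hi, rfl⟩))
  have hpowN : ∀ b ∈ B, b * x ^ N ∈ M := by
    intro b hb
    have h := hx
    rw [Polynomial.eval_eq_sum_range, Finset.sum_range_succ, ← hN, hp.coeff_natDegree,
      one_mul] at h
    -- Monicity expresses the top power through lower ones, with coefficients still in B.
    have : b * x ^ N = - ∑ i ∈ Finset.range N, (b * p.coeff i) * x ^ i := by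
      rw [eq_neg_of_add_eq_zero_right h, mul_neg, Finset.mul_sum]
      simp only [mul_assoc]
    rw [this]
    exact M.neg_mem (M.sum_mem fun i hi =>
      hpow i (Finset.mem_range.1 hi) _ (B.mul_mem hb (hB i)))
  have h1 : (1 : C) ∈ M := by
    by_cases h0 : N = 0
    · have := hpowN 1 B.one_mem
      rwa [h0, pow_zero, mul_one] at this
    · have := hpow 0 (Nat.pos_of_ne_zero h0) 1 B.one_mem
      rwa [pow_zero, mul_one] at this
  have hxM : ∀ m ∈ M, x * m ∈ M := by
    intro m hm
    refine Submodule.mul_induction_on hm ?_ ?_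
    · intro b hb y hy
      refine Submodule.span_induction ?_ ?_ ?_ ?_ hy
      · intro y hy
        simp only [Finset.coe_image, Finset.coe_range, Set.mem_image, Set.mem_Iio] at hy
        obtain ⟨i, hi, rfl⟩ := hy
        rw [show x * (b * x ^ i) = b * x ^ (i + 1) by ring]
        rcases Nat.lt_or_ge (i + 1) N with h | h
        · exact hpow _ h _ hb
        · rw [show i + 1 = N by omega]
          exact hpowN _ hb
      · simp
      · intro y z _ _ hy hz
        rw [mul_add, mul_add]
        exact M.add_mem hy hz
      · intro r y _ hy
        rw [mul_smul_comm, mul_smul_comm]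
        exact M.smul_mem r hy
    · intro y z hy hz
      rw [mul_add]
      exact M.add_mem hy hz
  have hsup : B ⊔ Algebra.adjoin R {x} = Algebra.adjoin R ((B : Set C) ∪ {x}) := by
    rw [Algebra.adjoin_union, Algebra.adjoin_eq]
  rw [hsup]
  refine toSubmodule_adjoin_le h1 ?_
  rintro s (hs | hs) m hm
  · exact mul_mem_toSubmodule_mul hs hm
  · rw [Set.mem_singleton_iff.1 hs]
    exact hxM m hm

open Polynomial in
/-- Adjoining to `B` all the roots of a monic polynomial of degree `N` with coefficients in `B`
gives a `B`-module with `N!` generators. -/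
theorem exists_generators_adjoin_roots (s : Multiset C) : ∀ B : Subalgebra R C,
    (∀ k, ((s.map fun x => (X - Polynomial.C x : C[X])).prod).coeff k ∈ B) →
    ∃ T : Finset C, T.card ≤ (Multiset.card s).factorial ∧
      Subalgebra.toSubmodule (B ⊔ Algebra.adjoin R {x | x ∈ s}) ≤
        Subalgebra.toSubmodule B * Submodule.span R (T : Set C) := by
  classical
  induction s using Multiset.induction with
  | empty =>
    intro B _
    refine ⟨{1}, by simp, ?_⟩
    have h0 : Submodule.span R ({(1 : C)} : Set C) = 1 := Submodule.one_eq_span.symm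
    simp [h0]
  | cons x s ih =>
    intro B hB
    rcases subsingleton_or_nontrivial C with hC | hC
    · refine ⟨∅, by simp, fun y _ => ?_⟩
      rw [Subsingleton.elim y 0]
      exact Submodule.zero_mem _
    rw [Multiset.map_cons, Multiset.prod_cons] at hB
    set q := (s.map fun x => (X - Polynomial.C x : C[X])).prod with hq
    have hqm : q.Monic := monic_multiset_prod_of_monic _ _ fun x _ => monic_X_sub_C x
    have hqdeg : q.natDegree = Multiset.card s := natDegree_multiset_prod_X_sub_C_eq_card s
    set B' := B ⊔ Algebra.adjoin R {x} with hB'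
    have hBB' : B ≤ B' := le_sup_left
    have hxB' : x ∈ B' := (le_sup_right : _ ≤ B') (Algebra.subset_adjoin rfl)
    -- Synthetic division by X - x: the k-th coefficient of q is the (k+1)-st of the product plus x
    -- times the (k+1)-st of q, so one descends from above the degree.
    have hq' : ∀ m k, q.natDegree < k + m → q.coeff k ∈ B' := by
      intro m
      induction m with
      | zero =>
        intro k hk
        rw [coeff_eq_zero_of_natDegree_lt (by simpa using hk)]
        exact B'.zero_mem
      | succ m ihm =>
        intro k hk
        have h1 := hBB' (hB (k + 1))
        rw [sub_mul, coeff_sub, coeff_X_mul, coeff_C_mul] at h1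
        have := B'.add_mem h1 (B'.mul_mem hxB' (ihm (k + 1) (by omega)))
        simpa using this
    obtain ⟨T, hT, hle⟩ := ih B' fun k => hq' (q.natDegree + 1) k (by omega)
    have hpm : ((X - Polynomial.C x) * q).Monic := (monic_X_sub_C x).mul hqm
    have hpdeg : ((X - Polynomial.C x) * q).natDegree = Multiset.card s + 1 := by
      rw [(monic_X_sub_C x).natDegree_mul hqm, hqdeg, natDegree_X_sub_C, add_comm]
    have hroot := adjoin_root_le B x _ hpm hB (by simp)
    rw [hpdeg] at hroot
    set P : Finset C := (Finset.range (Multiset.card s + 1)).image fun i => x ^ i with hP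
    refine ⟨(P ×ˢ T).image fun y => y.1 * y.2, ?_, ?_⟩
    · refine Finset.card_image_le.trans ?_
      rw [Finset.card_product, Multiset.card_cons, Nat.factorial_succ]
      exact Nat.mul_le_mul (Finset.card_image_le.trans (by simp)) hT
    · have e1 : B ⊔ Algebra.adjoin R {y | y ∈ x ::ₘ s} = B' ⊔ Algebra.adjoin R {y | y ∈ s} := by
        rw [hB', sup_assoc, ← Algebra.adjoin_union]
        congr 2
        ext y
        simp
      rw [e1, coe_image_mul_product, ← Submodule.span_mul_span, ← mul_assoc]
      exact hle.trans (mul_le_mul' hroot le_rfl)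

/-- Reduction of products of elements `F l` to products over distinct `l`, given quadratic
relations. -/
theorem multiset_prod_mem_span (n : ℕ) (F : ℕ → C) (e : ℕ → R)
    (hF : ∀ l, ¬ (0 < l ∧ l < n) → ∃ r : R, F l = algebraMap R C r)
    (hquad : ∀ k, 1 ≤ k → k ≤ n → ∑ j ∈ Finset.Icc 1 (2 * k),
      (-1) ^ j * F j * (F (2 * k - j) + algebraMap R C (e (2 * k - j))) = 0)
    (m : Multiset ℕ) :
    (m.map F).prod ∈ Submodule.span R
      ((fun U : Finset ℕ => ∏ l ∈ U, F l) '' {U | U ⊆ Finset.Ioo 0 n}) := by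
  set S := Submodule.span R
      ((fun U : Finset ℕ => ∏ l ∈ U, F l) '' {U | U ⊆ Finset.Ioo 0 n}) with hS
  -- Termination weight. Strict concavity of 2n² - a² makes replacing (k, k) by (j, 2k - j) with j ≠
  -- k decrease the total; the values lie between n² and 2n², so replacing (k, k) by a single index
  -- decreases it too. Indices from n on get weight 1, enough for their removal to count.
  let c : ℕ → ℕ := fun a => if a < n then 2 * n ^ 2 - a ^ 2 else 1
  have hcpos : ∀ a, 0 < c a := by
    intro a
    by_cases h : a < n
    · simp only [c, h, if_true]
      have : a ^ 2 < n ^ 2 := Nat.pow_lt_pow_left h (by norm_num)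
      omega
    · simp [c, h]
  have hc1 : ∀ k, 0 < k → k < n → ∀ j, c j < 2 * c k := by
    intro k hk hkn j
    have h2 : k ^ 2 < n ^ 2 := Nat.pow_lt_pow_left hkn (by norm_num)
    by_cases h : j < n
    · simp only [c, h, hkn, if_true]
      omega
    · simp only [c, h, hkn, if_true, if_false]
      omega
  have hc2 : ∀ k, 0 < k → k < n → ∀ j ≤ 2 * k, j ≠ k → c j + c (2 * k - j) < 2 * c k := by
    intro k hk hkn j hj hjk
    obtain ⟨i, hi⟩ : ∃ i, i = 2 * k - j := ⟨_, rfl⟩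
    rw [← hi]
    have hij : i + j = 2 * k := by omega
    have h2 : (k + 1) ^ 2 ≤ n ^ 2 := Nat.pow_le_pow_left hkn 2
    have h3 : 2 * k ^ 2 < i ^ 2 + j ^ 2 := by
      zify at hij ⊢
      have h4 : (0 : ℤ) < ((j : ℤ) - k) ^ 2 := by
        have : (j : ℤ) - k ≠ 0 := by omega
        positivity
      have : (i : ℤ) = 2 * k - j := by linarith
      rw [this]
      nlinarith
    by_cases h : j < n <;> by_cases h' : i < n
    · simp only [c, h, h', hkn, if_true]
      have : j ^ 2 < n ^ 2 := Nat.pow_lt_pow_left h (by norm_num)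
      have : i ^ 2 < n ^ 2 := Nat.pow_lt_pow_left h' (by norm_num)
      have : k ^ 2 < n ^ 2 := Nat.pow_lt_pow_left hkn (by norm_num)
      omega
    · simp only [c, h, h', hkn, if_true, if_false]
      nlinarith [Nat.sub_le (2 * n ^ 2) (j ^ 2), Nat.le_sub_of_add_le (show
        n ^ 2 + 2 * k + 1 + k ^ 2 ≤ 2 * n ^ 2 by nlinarith)]
    · simp only [c, h, h', hkn, if_true, if_false]
      nlinarith [Nat.sub_le (2 * n ^ 2) (i ^ 2), Nat.le_sub_of_add_le (show
        n ^ 2 + 2 * k + 1 + k ^ 2 ≤ 2 * n ^ 2 by nlinarith)]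
    · omega
  obtain ⟨N, hN⟩ : ∃ N, (m.map c).sum = N := ⟨_, rfl⟩
  induction N using Nat.strong_induction_on generalizing m with
  | _ N ih =>
  subst hN
  by_cases hout : ∃ a ∈ m, ¬ (0 < a ∧ a < n)
  · obtain ⟨a, ha, han⟩ := hout
    obtain ⟨r, hr⟩ := hF a han
    obtain ⟨m', rfl⟩ := Multiset.exists_cons_of_mem ha
    rw [Multiset.map_cons, Multiset.prod_cons, hr, ← Algebra.smul_def]
    refine S.smul_mem r (ih _ ?_ m' rfl)
    rw [Multiset.map_cons, Multiset.sum_cons]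
    exact Nat.lt_add_of_pos_left (hcpos a)
  push Not at hout
  by_cases hnd : m.Nodup
  · refine Submodule.subset_span ⟨⟨m, hnd⟩, ?_, rfl⟩
    intro a ha
    exact Finset.mem_Ioo.2 (hout a ha)
  · obtain ⟨k, hk⟩ : ∃ k, 2 ≤ m.count k := by
      by_contra! hcon
      exact hnd (Multiset.nodup_iff_count_le_one.2 fun a => by have := hcon a; omega)
    obtain ⟨m', rfl⟩ : ∃ m', m = k ::ₘ k ::ₘ m' := by
      obtain ⟨m', h⟩ := Multiset.le_iff_exists_add.1 (Multiset.le_count_iff_replicate_le.1 hk)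
      exact ⟨m', by rw [h]; simp [Multiset.replicate_succ]⟩
    obtain ⟨hk0, hkn⟩ := hout k (Multiset.mem_cons_self _ _)
    have hpair : ∀ j ≤ 2 * k, j ≠ k → F j * F (2 * k - j) * (m'.map F).prod ∈ S := by
      intro j hj hjk
      have := ih _ ?_ (j ::ₘ (2 * k - j) ::ₘ m') rfl
      · simpa [mul_assoc] using this
      · simp only [Multiset.map_cons, Multiset.sum_cons]
        have := hc2 k hk0 hkn j hj hjk
        omega
    have hone : ∀ j, F j * (m'.map F).prod ∈ S := by
      intro j
      have := ih _ ?_ (j ::ₘ m') rfl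
      · simpa using this
      · simp only [Multiset.map_cons, Multiset.sum_cons]
        have := hc1 k hk0 hkn j
        omega
    have hsign : ∀ (j : ℕ) (x : C), x ∈ S → (-1) ^ j * x ∈ S := by
      intro j x hx
      rcases neg_one_pow_eq_or C j with h | h <;> rw [h]
      · simpa using hx
      · simpa using S.neg_mem hx
    -- The term j = k contains ±F k²; solving for it leaves only products of smaller weight.
    have hk' := hquad k hk0 hkn.le
    rw [← Finset.add_sum_erase _ _ (Finset.mem_Icc.2 (by omega : 1 ≤ k ∧ k ≤ 2 * k)),
      show 2 * k - k = k by omega] at hk'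
    have hone' : ∀ j i, (-1) ^ j * (F j * algebraMap R C (e i) * (m'.map F).prod) ∈ S := by
      intro j i
      refine hsign _ _ ?_
      rw [mul_comm (F j), mul_assoc, ← Algebra.smul_def]
      exact S.smul_mem _ (hone j)
    have hrest : (∑ j ∈ (Finset.Icc 1 (2 * k)).erase k, (-1) ^ j * F j *
        (F (2 * k - j) + algebraMap R C (e (2 * k - j)))) * (m'.map F).prod ∈ S := by
      rw [Finset.sum_mul]
      refine S.sum_mem fun j hj => ?_
      have h1 := hsign j _ (hpair j (by simp at hj; omega) (by simp at hj; omega))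
      convert S.add_mem h1 (hone' j (2 * k - j)) using 1
      ring
    have hfin : (-1) ^ k * (F k * F k * (m'.map F).prod) ∈ S := by
      have : (-1) ^ k * (F k * F k * (m'.map F).prod) = -
          ((-1) ^ k * (F k * algebraMap R C (e k) * (m'.map F).prod) +
          (∑ j ∈ (Finset.Icc 1 (2 * k)).erase k, (-1) ^ j * F j *
            (F (2 * k - j) + algebraMap R C (e (2 * k - j)))) * (m'.map F).prod) := by
        linear_combination (m'.map F).prod * hk'
      rw [this]
      exact S.neg_mem (S.add_mem (hone' k k) hrest)
    have := hsign k _ hfin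
    rw [← mul_assoc, ← mul_pow] at this
    simpa [mul_assoc] using this

/-- An algebra generated by `n` elements `τ` and elements `F l`, `0 < l < n`, subject to quadratic
relations for the `F l` and such that the elementary symmetric polynomials in the `τ` are
polynomials in the `F l`, has `2 ^ (n - 1) * n!` module generators. -/
theorem exists_generators {n : ℕ} (F : ℕ → C) (e : ℕ → R) (τ : Fin n → C)
    (hF : ∀ l, ¬ (0 < l ∧ l < n) → ∃ r : R, F l = algebraMap R C r)
    (hquad : ∀ k, 1 ≤ k → k ≤ n → ∑ j ∈ Finset.Icc 1 (2 * k),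
      (-1) ^ j * F j * (F (2 * k - j) + algebraMap R C (e (2 * k - j))) = 0)
    (hτ : ∀ l, (Finset.univ.val.map τ).esymm l ∈ Algebra.adjoin R (Set.range F))
    (hgen : Algebra.adjoin R (Set.range F ∪ Set.range τ) = ⊤) :
    ∃ T : Finset C, T.card ≤ 2 ^ (n - 1) * n.factorial ∧
      Submodule.span R (T : Set C) = ⊤ := by
  classical
  obtain ⟨T, hT, hle⟩ := exists_generators_adjoin_roots (R := R) (Finset.univ.val.map τ)
    (Algebra.adjoin R (Set.range F)) (by
      intro k
      set s := Finset.univ.val.map τ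
      rcases Nat.lt_or_ge (Multiset.card s) k with h | h
      · nontriviality C
        rw [Polynomial.coeff_eq_zero_of_natDegree_lt
          (by rwa [Polynomial.natDegree_multiset_prod_X_sub_C_eq_card])]
        exact Subalgebra.zero_mem _
      · rw [Multiset.prod_X_sub_C_coeff s h]
        exact Subalgebra.mul_mem _ (Subalgebra.pow_mem _ (Subalgebra.neg_mem _
          (Subalgebra.one_mem _)) _) (hτ _))
  set S1 : Finset C := (Finset.Ioo 0 n).powerset.image fun U => ∏ l ∈ U, F l with hS1
  have hS1c : S1.card ≤ 2 ^ (n - 1) := by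
    refine Finset.card_image_le.trans ?_
    simp
  have hB : Subalgebra.toSubmodule (Algebra.adjoin R (Set.range F)) ≤
      Submodule.span R (S1 : Set C) := by
    rw [Algebra.adjoin_eq_span, Submodule.span_le]
    intro x hx
    obtain ⟨M, hM, rfl⟩ := Submonoid.exists_multiset_of_mem_closure hx
    choose! g hg using hM
    have h1 : M = (M.map g).map F := by
      rw [Multiset.map_map]
      conv_lhs => rw [← Multiset.map_id M]
      exact Multiset.map_congr rfl fun y hy => (hg y hy).symm
    rw [h1]
    have := multiset_prod_mem_span n F e hF hquad (M.map g)
    rwa [show (S1 : Set C) = (fun U : Finset ℕ => ∏ l ∈ U, F l) '' {U | U ⊆ Finset.Ioo 0 n} by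
      simp only [hS1, Finset.coe_image, Finset.coe_powerset]
      rfl]
  refine ⟨(S1 ×ˢ T).image fun y => y.1 * y.2, ?_, ?_⟩
  · refine Finset.card_image_le.trans ?_
    rw [Finset.card_product]
    exact Nat.mul_le_mul hS1c (by simpa using hT)
  · rw [coe_image_mul_product, ← Submodule.span_mul_span, eq_top_iff]
    refine le_trans ?_ (hle.trans (mul_le_mul' hB le_rfl))
    rw [← Algebra.adjoin_union]
    have e3 : {x | x ∈ Finset.univ.val.map τ} = Set.range τ := by
      ext y
      simp
    rw [e3, hgen]
    simp

end Generators

end GKM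

namespace GKM

/-! ### Polynomial lemmas -/

section Polynomials

open MvPolynomial

theorem dvd_aeval_sub_aeval {σ S : Type*} [CommRing S] {d : S} {a b : σ → S}
    (h : ∀ i, d ∣ a i - b i) (p : MvPolynomial σ ℤ) : d ∣ aeval a p - aeval b p := by
  induction p using MvPolynomial.induction_on with
  | C r => simp
  | add p q hp hq =>
    rw [map_add, map_add, add_sub_add_comm]
    exact dvd_add hp hq
  | mul_X p i hp =>
    rw [map_mul, map_mul, aeval_X, aeval_X]
    have := dvd_add (hp.mul_left (a i)) ((h i).mul_left (aeval b p))
    convert this using 1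
    ring

variable {n : ℕ}

/-- The linear form `t_a - ε t_b`. Up to sign, these are the roots. -/
noncomputable def rootForm (a b : Fin n) (ε : ℤˣ) : HBT n := X a - C (ε : ℤ) * X b

/-- The substitution `t_a ↦ ε t_b`, which kills `t_a - ε t_b`. -/
noncomputable def killRoot (a b : Fin n) (ε : ℤˣ) : HBT n →ₐ[ℤ] HBT n :=
  aeval fun i => if i = a then C (ε : ℤ) * X b else X i

/-- Every variable is congruent to its image under the substitution modulo the root, so the root
generates the kernel. The target is a domain of characteristic 0, which yields primality of the root
and coprimality to 2. -/
theorem rootForm_dvd_iff {a b : Fin n} (hab : a ≠ b) (ε : ℤˣ) (p : HBT n) :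
    rootForm a b ε ∣ p ↔ killRoot a b ε p = 0 := by
  constructor
  · rintro ⟨q, rfl⟩
    rw [map_mul]
    simp [rootForm, killRoot, hab.symm]
  · intro h
    have : rootForm a b ε ∣ aeval X p - killRoot a b ε p :=
      dvd_aeval_sub_aeval (fun i => ?_) p
    · rwa [aeval_X_left_apply, h, sub_zero] at this
    · by_cases hi : i = a
      · simp [hi, rootForm]
      · simp [hi]

theorem prime_rootForm {a b : Fin n} (hab : a ≠ b) (ε : ℤˣ) : Prime (rootForm a b ε) := by
  refine ⟨?_, ?_, ?_⟩
  · intro h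
    have := congrArg (aeval (fun i => if i = a then (1 : ℤ) else 0)) h
    simp [rootForm, hab.symm] at this
  · intro h
    have := (rootForm_dvd_iff hab ε 1).1 h.dvd
    simp at this
  · intro p q h
    rw [rootForm_dvd_iff hab, map_mul, mul_eq_zero] at h
    rwa [rootForm_dvd_iff hab, rootForm_dvd_iff hab]

theorem killRoot_two_ne_zero (a b : Fin n) (ε : ℤˣ) : killRoot a b ε 2 ≠ 0 := by
  rw [map_ofNat]
  exact two_ne_zero

theorem rootForm_dvd_of_dvd_two_mul {a b : Fin n} (hab : a ≠ b) (ε : ℤˣ) {p : HBT n}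
    (h : rootForm a b ε ∣ 2 * p) : rootForm a b ε ∣ p := by
  rw [rootForm_dvd_iff hab, map_mul, mul_eq_zero] at h
  rw [rootForm_dvd_iff hab]
  exact h.resolve_left (killRoot_two_ne_zero a b ε)

theorem not_rootForm_dvd_two {a b : Fin n} (hab : a ≠ b) (ε : ℤˣ) : ¬ rootForm a b ε ∣ 2 := by
  rw [rootForm_dvd_iff hab]
  exact killRoot_two_ne_zero a b ε

theorem not_three_dvd_rootForm {a b : Fin n} (hab : a ≠ b) (ε : ℤˣ) :
    ¬ (C 3 : HBT n) ∣ rootForm a b ε := by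
  intro h
  have := map_dvd (aeval (fun i => if i = a then (1 : ℤ) else 0)) h
  simp [rootForm, hab.symm] at this

/-- The values of the elementary symmetric polynomials as explicit sums. -/
theorem aeval_esymm {S : Type*} [CommRing S] [Algebra ℤ S] (a : Fin n → S) (l : ℕ) :
    aeval a (esymm (Fin n) ℤ l) = ∑ t ∈ Finset.univ.powersetCard l, ∏ i ∈ t, a i := by
  simp [esymm, map_sum, map_prod]

theorem esymm_eq_zero_of_lt {l : ℕ} (h : n < l) : esymm (Fin n) ℤ l = 0 := by
  rw [esymm, Finset.powersetCard_eq_empty.2 (by simpa using h), Finset.sum_empty]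

theorem aeval_esymm_card {S : Type*} [CommRing S] [Algebra ℤ S] (a : Fin n → S) :
    aeval a (esymm (Fin n) ℤ n) = ∏ i, a i := by
  rw [aeval_esymm]
  have : (Finset.univ : Finset (Fin n)).powersetCard n = {Finset.univ} := by
    have h := Finset.powersetCard_self (Finset.univ : Finset (Fin n))
    rwa [Finset.card_univ, Fintype.card_fin] at h
  rw [this, Finset.sum_singleton]

theorem coeff_prod_one_add {S : Type*} [CommRing S] [Algebra ℤ S] (a : Fin n → S) (l : ℕ) :
    (∏ i, (1 + Polynomial.C (a i) * Polynomial.X)).coeff l = aeval a (esymm (Fin n) ℤ l) := by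
  rw [Finset.prod_one_add, Polynomial.finsetSum_coeff, aeval_esymm,
    Finset.powersetCard_eq_filter, Finset.sum_filter]
  refine Finset.sum_congr rfl fun t _ => ?_
  rw [Finset.prod_mul_distrib, Finset.prod_const, ← map_prod, Polynomial.coeff_C_mul_X_pow]
  simp only [eq_comm]

/-- The alternating quadratic expressions in the elementary symmetric polynomials only depend on the
squares of the variables, up to permutation. -/
theorem sum_esymm_mul_esymm {S : Type*} [CommRing S] [Algebra ℤ S] (a b : Fin n → S) (p : Equiv.Perm (Fin n))
    (h : ∀ i, a i ^ 2 = b (p i) ^ 2) (k : ℕ) :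
    ∑ j ∈ Finset.range (k + 1), (-1) ^ j * aeval a (esymm (Fin n) ℤ j) *
        aeval a (esymm (Fin n) ℤ (k - j)) =
      ∑ j ∈ Finset.range (k + 1), (-1) ^ j * aeval b (esymm (Fin n) ℤ j) *
        aeval b (esymm (Fin n) ℤ (k - j)) := by
  -- Generating function: ∏(1 - a_i X) · ∏(1 + a_i X) = ∏(1 - a_i² X²).
  have key : ∀ a : Fin n → S, ∑ j ∈ Finset.range (k + 1), (-1) ^ j * aeval a (esymm (Fin n) ℤ j) *
        aeval a (esymm (Fin n) ℤ (k - j)) =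
      (∏ i, (1 - Polynomial.C (a i ^ 2) * Polynomial.X ^ 2)).coeff k := by
    intro a
    have h1 : ∏ i, (1 - Polynomial.C (a i ^ 2) * Polynomial.X ^ 2) =
        (∏ i, (1 + Polynomial.C (-a i) * Polynomial.X)) *
          ∏ i, (1 + Polynomial.C (a i) * Polynomial.X) := by
      rw [← Finset.prod_mul_distrib]
      refine Finset.prod_congr rfl fun i _ => ?_
      simp only [map_neg, map_pow]
      ring
    rw [h1, Polynomial.coeff_mul, Finset.Nat.sum_antidiagonal_eq_sum_range_succ_mk]
    refine Finset.sum_congr rfl fun j _ => ?_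
    rw [coeff_prod_one_add (fun i => - a i), coeff_prod_one_add a]
    congr 1
    rw [aeval_esymm, aeval_esymm, Finset.mul_sum]
    refine Finset.sum_congr rfl fun t ht => ?_
    rw [Finset.prod_neg, (Finset.mem_powersetCard.1 ht).2]
  rw [key, key]
  congr 1
  rw [← Equiv.prod_comp p fun i => 1 - Polynomial.C (b i ^ 2) * Polynomial.X ^ 2]
  exact Finset.prod_congr rfl fun i _ => by rw [h]

/-- Since E = e + 2F, four times each summand is (E_j - e_j)(E_{2k-j} + e_{2k-j}) up to the sign.
The mixed terms cancel under j ↦ 2k - j, which preserves the sign because 2k is even, and 4 is not a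
zero divisor. -/
theorem sum_half_mul_eq_zero {S : Type*} [CommRing S] [IsDomain S] [CharZero S] {E e F : ℕ → S}
    {k : ℕ} (hF0 : F 0 = 0) (hF : ∀ l, 2 * F l = E l - e l)
    (h : ∑ j ∈ Finset.range (2 * k + 1), (-1) ^ j * E j * E (2 * k - j) =
      ∑ j ∈ Finset.range (2 * k + 1), (-1) ^ j * e j * e (2 * k - j)) :
    ∑ j ∈ Finset.Icc 1 (2 * k), (-1) ^ j * F j * (F (2 * k - j) + e (2 * k - j)) = 0 := by
  have hcross : ∑ j ∈ Finset.range (2 * k + 1), (-1) ^ j * E j * e (2 * k - j) =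
      ∑ j ∈ Finset.range (2 * k + 1), (-1) ^ j * e j * E (2 * k - j) := by
    rw [← Finset.sum_range_reflect]
    refine Finset.sum_congr rfl fun j hj => ?_
    have hj : j ≤ 2 * k := Nat.lt_succ_iff.1 (Finset.mem_range.1 hj)
    have hs : (-1 : S) ^ (2 * k - j) = (-1) ^ j := by
      have h1 : (-1 : S) ^ (2 * k - j) * (-1) ^ j = 1 := by
        rw [← pow_add, Nat.sub_add_cancel hj, pow_mul]
        simp
      rcases neg_one_pow_eq_or S j with h | h <;> rw [h] at h1 ⊢
      · simpa using h1
      · linear_combination -h1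
    rw [show 2 * k + 1 - 1 - j = 2 * k - j by omega, hs, Nat.sub_sub_self hj]
    ring
  have h0 : ∑ j ∈ Finset.Icc 1 (2 * k), (-1) ^ j * F j * (F (2 * k - j) + e (2 * k - j)) =
      ∑ j ∈ Finset.range (2 * k + 1), (-1) ^ j * F j * (F (2 * k - j) + e (2 * k - j)) := by
    refine Finset.sum_subset ?_ ?_
    · intro j hj
      simp at hj ⊢
      omega
    · intro j hj hj'
      have : j = 0 := by
        simp at hj hj'
        omega
      simp [this, hF0]
  have h4 : 4 * ∑ j ∈ Finset.range (2 * k + 1),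
      (-1) ^ j * F j * (F (2 * k - j) + e (2 * k - j)) = 0 := by
    calc 4 * ∑ j ∈ Finset.range (2 * k + 1), (-1) ^ j * F j * (F (2 * k - j) + e (2 * k - j))
        = ∑ j ∈ Finset.range (2 * k + 1), ((-1) ^ j * E j * E (2 * k - j) -
          (-1) ^ j * e j * e (2 * k - j) + ((-1) ^ j * E j * e (2 * k - j) -
            (-1) ^ j * e j * E (2 * k - j))) := by
          rw [Finset.mul_sum]
          refine Finset.sum_congr rfl fun j _ => ?_
          linear_combination (-1) ^ j * (E (2 * k - j) + e (2 * k - j)) * hF j +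
            (-1) ^ j * 2 * F j * hF (2 * k - j)
      _ = 0 := by
          rw [Finset.sum_add_distrib, Finset.sum_sub_distrib, Finset.sum_sub_distrib, h, hcross]
          ring
  rw [h0]
  exact (mul_eq_zero.1 h4).resolve_left (by norm_num)

/-- Homogeneous substitutions are homogeneous. -/
theorem isWeightedHomogeneous_aeval {σ τ : Type*} {wσ : σ → ℕ} {wτ : τ → ℕ}
    {g : σ → MvPolynomial τ ℤ} (hg : ∀ i, IsWeightedHomogeneous wτ (g i) (wσ i))
    {p : MvPolynomial σ ℤ} {d : ℕ} (hp : IsWeightedHomogeneous wσ p d) :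
    IsWeightedHomogeneous wτ (aeval g p) d := by
  rw [aeval_def, eval₂_eq]
  refine IsWeightedHomogeneous.sum _ _ _ fun m hm => ?_
  have hd : d = ∑ i ∈ m.support, m i * wσ i := by
    rw [← hp (mem_support_iff.1 hm), Finsupp.weight_apply, Finsupp.sum]
    simp
  rw [hd]
  refine IsWeightedHomogeneous.C_mul (IsWeightedHomogeneous.prod _ _ _ fun i _ => ?_) _
  simpa using (hg i).pow (m i)

theorem isWeightedHomogeneous_of_mul_left {τ : Type*} {wτ : τ → ℕ} {c : ℤ} (hc : c ≠ 0)
    {p : MvPolynomial τ ℤ} {d : ℕ} (h : IsWeightedHomogeneous wτ (C c * p) d) :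
    IsWeightedHomogeneous wτ p d := by
  intro m hm
  exact h (by rw [coeff_C_mul]; exact mul_ne_zero hc hm)

end Polynomials

end GKM

namespace GKM

/-! ### Signed permutations, roots and edges -/

section SignedPermutations

open MvPolynomial

variable {n : ℕ}

theorem toHBT_single (i : Fin n) (c : ℤ) : H2.toHBT (Pi.single i c) = C c * X i := by
  rw [H2.toHBT, Finset.sum_eq_single i]
  · simp
  · intro j _ hj
    simp [hj]
  · simp

theorem toHBT_tAt (w : SignedPerm n) (i : Fin n) :
    (w.tAt i).toHBT = C (w.sign i : ℤ) * X (w.perm i) :=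
  toHBT_single _ _

theorem toHBT_sub (x y : H2 n) : (x - y).toHBT = x.toHBT - y.toHBT := by
  simp [H2.toHBT, sub_mul, Finset.sum_sub_distrib]

theorem toHBT_smul (c : ℤ) (x : H2 n) : (c • x).toHBT = C c * x.toHBT := by
  simp [H2.toHBT, Finset.mul_sum, mul_assoc]

theorem act_sub (w : SignedPerm n) (x y : H2 n) : w.act (x - y) = w.act x - w.act y := by
  simp [SignedPerm.act, sub_smul, Finset.sum_sub_distrib]

theorem act_smul (w : SignedPerm n) (c : ℤ) (x : H2 n) : w.act (c • x) = c • w.act x := by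
  simp [SignedPerm.act, Finset.smul_sum, mul_smul]

theorem act_tBasis (w : SignedPerm n) (i : Fin n) : w.act (tBasis i) = w.tAt i := by
  rw [SignedPerm.act, Finset.sum_eq_single i]
  · simp [tBasis]
  · intro j _ hj
    simp [tBasis, hj]
  · simp

theorem mem_rootsD_iff (r : H2 n) : r ∈ rootsD n ↔ ∃ (i j : Fin n) (u η : ℤˣ), i ≠ j ∧
    r = (u : ℤ) • (tBasis i - (η : ℤ) • tBasis j) := by
  constructor
  · rintro ⟨i, j, hij, h | h | h | h⟩
    · exact ⟨i, j, 1, -1, hij.ne, by simp [h]⟩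
    · exact ⟨i, j, -1, -1, hij.ne, by simp [h, add_comm]⟩
    · exact ⟨i, j, 1, 1, hij.ne, by simp [h]⟩
    · exact ⟨i, j, -1, 1, hij.ne, by simp [h]⟩
  · rintro ⟨i, j, u, η, hij, rfl⟩
    rcases lt_or_gt_of_ne hij with h | h
    · refine ⟨i, j, h, ?_⟩
      rcases Int.units_eq_one_or u with rfl | rfl <;>
        rcases Int.units_eq_one_or η with rfl | rfl <;> simp [add_comm]
    · refine ⟨j, i, h, ?_⟩
      rcases Int.units_eq_one_or u with rfl | rfl <;>
        rcases Int.units_eq_one_or η with rfl | rfl <;> simp [add_comm]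

theorem reflection_root {i j : Fin n} (hij : i ≠ j) (u η : ℤˣ) (x : H2 n) :
    reflection ((u : ℤ) • (tBasis i - (η : ℤ) • tBasis j)) x =
      x - (x i - η * x j) • (tBasis i - (η : ℤ) • tBasis j) := by
  have h1 : x ⬝ᵥ ((u : ℤ) • (tBasis i - (η : ℤ) • tBasis j)) = u * (x i - η * x j) := by
    rw [dotProduct_smul, dotProduct_sub, dotProduct_smul]
    simp [tBasis]
  have h2 : ((u : ℤ) • (tBasis i - (η : ℤ) • tBasis j) : H2 n) ⬝ᵥ
      ((u : ℤ) • (tBasis i - (η : ℤ) • tBasis j)) = 2 := by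
    rcases Int.units_eq_one_or u with rfl | rfl <;>
      rcases Int.units_eq_one_or η with rfl | rfl <;>
      simp [tBasis, hij, hij.symm]
  rw [reflection, h1, h2, Int.mul_ediv_cancel_left _ two_ne_zero, smul_smul]
  rcases Int.units_eq_one_or u with rfl | rfl <;> simp

/-- The signed permutation `s w`, where `s` is the reflection with `t_a ↦ ε t_b`, `t_b ↦ ε t_a`. -/
def SignedPerm.reflect (a b : Fin n) (ε : ℤˣ) (w : SignedPerm n) : SignedPerm n where
  perm := Equiv.swap a b * w.perm
  sign i := if w.perm i = a ∨ w.perm i = b then ε * w.sign i else w.sign i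

theorem reflect_reflect (a b : Fin n) (ε : ℤˣ) (w : SignedPerm n) :
    (w.reflect a b ε).reflect a b ε = w := by
  have h : ∀ i, Equiv.swap a b (w.perm i) = a ∨ Equiv.swap a b (w.perm i) = b ↔
      w.perm i = a ∨ w.perm i = b := by
    intro i
    rw [Equiv.swap_apply_eq_iff, Equiv.swap_apply_eq_iff, Equiv.swap_apply_left,
      Equiv.swap_apply_right]
    exact or_comm
  apply SignedPerm.ext
  · simp [SignedPerm.reflect, ← mul_assoc]
  · funext i
    simp only [SignedPerm.reflect, Equiv.Perm.mul_apply, h]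
    split_ifs
    · rw [← mul_assoc, Int.units_mul_self, one_mul]
    · rfl

theorem reflect_ne {a b : Fin n} (hab : a ≠ b) (ε : ℤˣ) (w : SignedPerm n) :
    w.reflect a b ε ≠ w := by
  intro h
  have := congrArg (fun w => w.perm) h
  simp only [SignedPerm.reflect] at this
  rw [mul_eq_right] at this
  exact hab (Equiv.swap_eq_one_iff.1 this)

/-- Exactly two signs are multiplied by ε, so reflections preserve each vertex set. -/
theorem prod_sign_reflect {a b : Fin n} (hab : a ≠ b) (ε : ℤˣ) (w : SignedPerm n) :
    ∏ i, (w.reflect a b ε).sign i = ∏ i, w.sign i := by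
  have h : ∀ i, (w.reflect a b ε).sign i =
      (if w.perm i = a then ε else 1) * (if w.perm i = b then ε else 1) * w.sign i := by
    intro i
    simp only [SignedPerm.reflect]
    by_cases h1 : w.perm i = a
    · simp [h1, hab]
    · by_cases h2 : w.perm i = b <;> simp [h1, h2, hab.symm]
  simp only [h, Finset.prod_mul_distrib]
  rw [Equiv.prod_comp w.perm fun i => if i = a then ε else 1,
    Equiv.prod_comp w.perm fun i => if i = b then ε else 1]
  simp [Int.units_mul_self]

theorem tAt_reflect {i j : Fin n} (hij : i ≠ j) (ε : ℤˣ) (w : SignedPerm n) (k : Fin n) :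
    (w.reflect (w.perm i) (w.perm j) ε).tAt k =
      w.tAt k - ((if k = i then 1 else 0) - (ε * w.sign i * w.sign j : ℤ) *
        (if k = j then 1 else 0)) • (w.tAt i - (ε * w.sign i * w.sign j : ℤ) • w.tAt j) := by
  have hsq : ∀ u : ℤˣ, (u : ℤ) * u = 1 := fun u => by
    rw [← Units.val_mul, Int.units_mul_self, Units.val_one]
  by_cases h1 : k = i
  · subst h1
    have : (ε * w.sign k * w.sign j * w.sign j : ℤ) = ε * w.sign k := by
      linear_combination (ε * w.sign k : ℤ) * hsq (w.sign j)
    simp [SignedPerm.tAt, SignedPerm.reflect, hij, ← Pi.single_smul', this]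
  · by_cases h2 : k = j
    · subst h2
      have : (ε * w.sign i * w.sign k * w.sign i : ℤ) = ε * w.sign k := by
        linear_combination (ε * w.sign k : ℤ) * hsq (w.sign i)
      have h3 : (ε * w.sign i * w.sign k * (ε * w.sign i * w.sign k * w.sign k) : ℤ) =
          w.sign k := by
        linear_combination (w.sign k : ℤ) * hsq ε * (w.sign i * w.sign i * w.sign k * w.sign k) +
          (w.sign k : ℤ) * hsq (w.sign i) * (w.sign k * w.sign k) +
          (w.sign k : ℤ) * hsq (w.sign k)
      simp [SignedPerm.tAt, SignedPerm.reflect, h1, ← Pi.single_smul', smul_sub, this, h3]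
    · have e1 : w.perm k ≠ w.perm i := fun h => h1 (w.perm.injective h)
      have e2 : w.perm k ≠ w.perm j := fun h => h2 (w.perm.injective h)
      simp [SignedPerm.tAt, SignedPerm.reflect, h1, h2, Equiv.swap_apply_of_ne_of_ne e1 e2]

/-- This is w σ_α = σ_{wα} w: edges are defined by multiplication on the right, whereas the label is
the root of the reflection on the left. The sign ε · sign i · sign j transports the root back
through w. -/
theorem act_reflect {i j : Fin n} (hij : i ≠ j) (ε : ℤˣ) (w : SignedPerm n) (x : H2 n) :
    (w.reflect (w.perm i) (w.perm j) ε).act x =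
      w.act x - (x i - (ε * w.sign i * w.sign j : ℤ) * x j) •
        (w.tAt i - (ε * w.sign i * w.sign j : ℤ) • w.tAt j) := by
  simp only [SignedPerm.act, tAt_reflect hij, smul_sub, Finset.sum_sub_distrib, smul_smul]
  simp only [← Finset.sum_smul]
  congr 3 <;> simp [mul_sub, Finset.sum_sub_distrib, mul_comm, mul_left_comm]

/-- The label of an edge is a root up to sign, and the endpoints are congruent modulo the label. -/
theorem isEdge_label {V : Set (SignedPerm n)} {w w' : V} {r : H2 n}
    (h : (rootGraph (rootsD n) V).IsEdge w w' r) :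
    (∃ (a b : Fin n) (u ε : ℤˣ), a ≠ b ∧ r.toHBT = C (u : ℤ) * rootForm a b ε) ∧
      ∀ i, r.toHBT ∣ (w.1.tAt i).toHBT - (w'.1.tAt i).toHBT := by
  obtain ⟨s, hs, hact, rfl⟩ := h
  obtain ⟨i, j, u, η, hij, rfl⟩ := (mem_rootsD_iff s).1 hs
  refine ⟨⟨w.1.perm i, w.1.perm j, u * w.1.sign i, η * w.1.sign i * w.1.sign j,
    fun e => hij (w.1.perm.injective e), ?_⟩, fun k => ?_⟩
  · rw [act_smul, act_sub, act_smul, act_tBasis, act_tBasis, toHBT_smul, toHBT_sub, toHBT_smul,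
      toHBT_tAt, toHBT_tAt, rootForm]
    rcases Int.units_eq_one_or (w.1.sign i) with h | h <;> simp [h] <;> ring
  · have h1 := hact (tBasis k)
    rw [reflection_root hij, act_tBasis, act_sub, act_tBasis, act_smul] at h1
    rw [h1, toHBT_sub, sub_sub_cancel, toHBT_smul, act_smul, toHBT_smul]
    refine Dvd.dvd.mul_left ?_ _
    rcases Int.units_eq_one_or u with rfl | rfl <;> simp

theorem exists_isEdge_reflect {V : Set (SignedPerm n)} (w w' : V) {a b : Fin n} (hab : a ≠ b)
    (ε : ℤˣ) (hw' : w'.1 = w.1.reflect a b ε) :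
    ∃ r, (rootGraph (rootsD n) V).IsEdge w w' r ∧ r.toHBT = rootForm a b ε := by
  obtain ⟨i, rfl⟩ := w.1.perm.surjective a
  obtain ⟨j, rfl⟩ := w.1.perm.surjective b
  have hij : i ≠ j := fun e => hab (by rw [e])
  have hη : ((ε * w.1.sign i * w.1.sign j : ℤˣ) : ℤ) = ε * w.1.sign i * w.1.sign j := by
    push_cast; rfl
  -- Scaling the root by `w.1.sign i` makes the label equal to `rootForm a b ε`, not just up to
  -- sign.
  refine ⟨_, ⟨_, (mem_rootsD_iff _).2
    ⟨i, j, w.1.sign i, ε * w.1.sign i * w.1.sign j, hij, rfl⟩, fun x => ?_, rfl⟩, ?_⟩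
  · rw [hw', act_reflect hij, reflection_root hij, act_sub, act_smul, act_sub, act_smul,
      act_tBasis, act_tBasis, hη]
  · rw [act_smul, act_sub, act_smul, act_tBasis, act_tBasis, toHBT_smul, toHBT_sub, toHBT_smul,
      toHBT_tAt, toHBT_tAt, rootForm]
    rcases Int.units_eq_one_or (w.1.sign i) with h | h <;>
      rcases Int.units_eq_one_or (w.1.sign j) with h' | h' <;> simp [h, h'] <;> ring

theorem C_mul_X_injective {u v : ℤˣ} {a b : Fin n}
    (h : (C (u : ℤ) * X a : HBT n) = C (v : ℤ) * X b) : u = v ∧ a = b := by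
  have h1 := congrArg (coeff (Finsupp.single a 1)) h
  rw [coeff_C_mul, coeff_C_mul, coeff_X, coeff_X] at h1
  by_cases hab : b = a
  · subst hab
    simp only [if_true, mul_one] at h1
    exact ⟨Units.ext h1, rfl⟩
  · simp [Finsupp.single_left_inj, hab] at h1

/-- Two signed permutations that are congruent modulo the root `t_a - ε t_b` are equal or related
by the reflection in that root. -/
theorem eq_or_eq_reflect {a b : Fin n} (hab : a ≠ b) (ε : ℤˣ) (w w' : SignedPerm n)
    (h : ∀ i, rootForm a b ε ∣ (w.tAt i).toHBT - (w'.tAt i).toHBT) :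
    w' = w ∨ w' = w.reflect a b ε := by
  have hval : ∀ (w : SignedPerm n) i, killRoot a b ε ((w.tAt i).toHBT) =
      C (((if w.perm i = a then ε * w.sign i else w.sign i) : ℤˣ) : ℤ) *
        X (if w.perm i = a then b else w.perm i) := by
    intro w i
    rw [toHBT_tAt, killRoot, map_mul, aeval_X]
    split_ifs with h
    · simp
      ring
    · simp
  have key : ∀ i, (if w.perm i = a then ε * w.sign i else w.sign i) =
      (if w'.perm i = a then ε * w'.sign i else w'.sign i) ∧
      (if w.perm i = a then b else w.perm i) = (if w'.perm i = a then b else w'.perm i) := by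
    intro i
    have := (rootForm_dvd_iff hab ε _).1 (h i)
    rw [map_sub, sub_eq_zero, hval, hval] at this
    exact C_mul_X_injective this
  obtain ⟨i, hi⟩ := w.perm.surjective a
  obtain ⟨j, hj⟩ := w.perm.surjective b
  have hij : i ≠ j := fun e => hab (by rw [← hi, ← hj, e])
  have hij' : w'.perm i ≠ w'.perm j := fun e => hij (w'.perm.injective e)
  have hεε : ∀ x, ε * (ε * x) = x := fun x => by rw [← mul_assoc, Int.units_mul_self, one_mul]
  -- After folding t_a onto ε t_b, the only information lost is which of the two positions i, j
  -- carries a; the two answers give w and its reflection.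
  by_cases hia : w'.perm i = a
  · left
    have hk : ∀ k, w'.perm k = w.perm k := by
      intro k
      have h1 := (key k).2
      by_cases hki : k = i
      · rw [hki, hi, hia]
      · have h2 : w.perm k ≠ a := fun e => hki (w.perm.injective (e.trans hi.symm))
        have h3 : w'.perm k ≠ a := fun e => hki (w'.perm.injective (e.trans hia.symm))
        rw [if_neg h2, if_neg h3] at h1
        exact h1.symm
    apply SignedPerm.ext
    · exact Equiv.ext hk
    · funext k
      have h1 := (key k).1
      rw [hk k] at h1
      split_ifs at h1
      · exact (mul_left_cancel h1).symm
      · exact h1.symm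
  · right
    have hib : w'.perm i = b := by
      have h1 := (key i).2
      rw [if_pos hi, if_neg hia] at h1
      exact h1.symm
    have hja : w'.perm j = a := by
      have h1 := (key j).2
      rw [if_neg (by rw [hj]; exact hab.symm), hj] at h1
      by_contra h2
      rw [if_neg h2] at h1
      exact hij' (hib.trans h1)
    apply SignedPerm.ext
    · ext1 k
      rw [SignedPerm.reflect, Equiv.Perm.mul_apply]
      by_cases hki : k = i
      · rw [hki, hi, hib, Equiv.swap_apply_left]
      · by_cases hkj : k = j
        · rw [hkj, hj, hja, Equiv.swap_apply_right]
        · have h2 : w.perm k ≠ a := fun e => hki (w.perm.injective (e.trans hi.symm))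
          have h2' : w.perm k ≠ b := fun e => hkj (w.perm.injective (e.trans hj.symm))
          have h3 : w'.perm k ≠ a := fun e => hkj (w'.perm.injective (e.trans hja.symm))
          have h1 := (key k).2
          rw [if_neg h2, if_neg h3] at h1
          rw [Equiv.swap_apply_of_ne_of_ne h2 h2', h1]
    · funext k
      have h1 := (key k).1
      simp only [SignedPerm.reflect]
      by_cases hki : k = i
      · subst hki
        rw [if_pos hi, if_neg hia] at h1
        rw [if_pos (Or.inl hi), h1]
      · have h2 : w.perm k ≠ a := fun e => hki (w.perm.injective (e.trans hi.symm))
        rw [if_neg h2] at h1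
        by_cases hkj : k = j
        · subst hkj
          rw [if_pos hja] at h1
          rw [if_pos (Or.inr hj), h1, hεε]
        · have h2' : w.perm k ≠ b := fun e => hkj (w.perm.injective (e.trans hj.symm))
          have h3 : w'.perm k ≠ a := fun e => hkj (w'.perm.injective (e.trans hja.symm))
          rw [if_neg h3] at h1
          rw [if_neg (not_or.2 ⟨h2, h2'⟩), h1]

/-- Taking i with |w(i)| = a provides the function with jump exactly the root that interpolation on
a pair needs. -/
theorem toHBT_tAt_sub_reflect (a b : Fin n) (ε : ℤˣ) (w : SignedPerm n) :
    ∃ i, C (w.sign i : ℤ) * ((w.tAt i).toHBT - ((w.reflect a b ε).tAt i).toHBT) =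
      rootForm a b ε := by
  obtain ⟨i, rfl⟩ := w.perm.surjective a
  refine ⟨i, ?_⟩
  rw [toHBT_tAt, toHBT_tAt, rootForm]
  simp only [SignedPerm.reflect, Equiv.Perm.mul_apply, Equiv.swap_apply_left, true_or, if_true]
  rcases Int.units_eq_one_or (w.sign i) with h | h <;> simp [h]
  ring

end SignedPermutations

end GKM

namespace GKM

/-! ### Evaluation at a vertex -/

section Evaluation

open MvPolynomial

variable {n : ℕ}

/-- Signs disappear modulo 2, and e_l is invariant under permutations. -/
theorem exists_two_mul_eq_esymm_sub (w : SignedPerm n) (l : ℕ) : ∃ q : HBT n,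
    aeval (fun i => (w.tAt i).toHBT) (esymm (Fin n) ℤ l) - esymm (Fin n) ℤ l = 2 * q := by
  have h1 : aeval (fun i => (X (w.perm i) : HBT n)) (esymm (Fin n) ℤ l) = esymm (Fin n) ℤ l := by
    have := congrArg (aeval (X : Fin n → HBT n)) (rename_esymm (Fin n) ℤ l w.perm)
    rwa [aeval_rename, aeval_X_left_apply] at this
  have h2 : (2 : HBT n) ∣ aeval (fun i => (w.tAt i).toHBT) (esymm (Fin n) ℤ l) -
      aeval (fun i => (X (w.perm i) : HBT n)) (esymm (Fin n) ℤ l) := by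
    refine dvd_aeval_sub_aeval (fun i => ?_) _
    rw [toHBT_tAt]
    rcases Int.units_eq_one_or (w.sign i) with h | h
    · simp [h]
    · exact ⟨-X (w.perm i), by simp [h]; ring⟩
  rw [h1] at h2
  exact h2

/-- The value `(e_l(τ) - e_l(t)) / 2` at a vertex. -/
noncomputable def halfDiff (w : SignedPerm n) (l : ℕ) : HBT n :=
  (exists_two_mul_eq_esymm_sub w l).choose

theorem two_mul_halfDiff (w : SignedPerm n) (l : ℕ) : 2 * halfDiff w l =
    aeval (fun i => (w.tAt i).toHBT) (esymm (Fin n) ℤ l) - esymm (Fin n) ℤ l :=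
  (exists_two_mul_eq_esymm_sub w l).choose_spec.symm

/-- The value of a generator at a vertex. -/
noncomputable def evalGen (w : SignedPerm n) : Gen n → HBT n
  | Gen.tau i => (w.tAt i).toHBT
  | Gen.t i => X i
  | Gen.f l _ _ => halfDiff w l

/-- The value of a polynomial in the generators at a vertex. -/
noncomputable def evalHom (w : SignedPerm n) : Poly n →ₐ[ℤ] HBT n := aeval (evalGen w)

theorem evalHom_rename_t (w : SignedPerm n) (p : HBT n) : evalHom w (rename Gen.t p) = p := by
  rw [evalHom, aeval_rename]
  exact aeval_X_left_apply p

theorem evalHom_eT (w : SignedPerm n) (l : ℕ) : evalHom w (eT n l) = esymm (Fin n) ℤ l :=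
  evalHom_rename_t w _

theorem evalHom_eTau (w : SignedPerm n) (l : ℕ) : evalHom w (eTau n l) =
    aeval (fun i => (w.tAt i).toHBT) (esymm (Fin n) ℤ l) := by
  rw [evalHom, eTau, aeval_rename]
  rfl

theorem isWeightedHomogeneous_evalGen (w : SignedPerm n) (g : Gen n) :
    IsWeightedHomogeneous (fun _ => 2) (evalGen w g) g.degree := by
  have hesymm : ∀ (a : Fin n → HBT n), (∀ i, IsWeightedHomogeneous (fun _ => 2) (a i) 2) → ∀ l,
      IsWeightedHomogeneous (fun _ => 2) (aeval a (esymm (Fin n) ℤ l)) (2 * l) := by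
    intro a ha l
    rw [aeval_esymm]
    refine IsWeightedHomogeneous.sum _ _ _ fun t ht => ?_
    have := IsWeightedHomogeneous.prod t a (fun _ => 2) fun i _ => ha i
    rwa [Finset.sum_const, (Finset.mem_powersetCard.1 ht).2, smul_eq_mul, mul_comm] at this
  have htau : ∀ i, IsWeightedHomogeneous (fun _ : Fin n => 2) (w.tAt i).toHBT 2 := by
    intro i
    rw [toHBT_tAt]
    exact (isWeightedHomogeneous_X ℤ _ _).C_mul _
  cases g with
  | tau i => exact htau i
  | t i => exact isWeightedHomogeneous_X ℤ _ _
  | f l _ _ =>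
    refine isWeightedHomogeneous_of_mul_left (c := 2) two_ne_zero ?_
    have h1 := (hesymm _ htau l).sub (hesymm X (fun i => isWeightedHomogeneous_X ℤ _ _) l)
    rw [aeval_X_left_apply, ← two_mul_halfDiff] at h1
    exact h1

theorem isWeightedHomogeneous_evalHom (w : SignedPerm n) {p : Poly n} {d : ℕ}
    (hp : IsWeightedHomogeneous Gen.degree p d) :
    IsWeightedHomogeneous (fun _ => 2) (evalHom w p) d :=
  isWeightedHomogeneous_aeval (isWeightedHomogeneous_evalGen w) hp

theorem weightedHomogeneousComponent_evalHom (w : SignedPerm n) (p : Poly n) (d : ℕ) :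
    weightedHomogeneousComponent (fun _ => 2) d (evalHom w p) =
      evalHom w (weightedHomogeneousComponent Gen.degree d p) := by
  classical
  conv_lhs => rw [← sum_weightedHomogeneousComponent Gen.degree p]
  have hfin := weightedHomogeneousComponent_finsupp (w := (Gen.degree : Gen n → ℕ)) p
  rw [finsum_eq_sum _ hfin, map_sum, map_sum]
  have hc : ∀ e, weightedHomogeneousComponent (fun _ => 2) d
      (evalHom w (weightedHomogeneousComponent Gen.degree e p)) =
      if e = d then evalHom w (weightedHomogeneousComponent Gen.degree d p) else 0 := by
    intro e
    have he := isWeightedHomogeneous_evalHom w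
      (weightedHomogeneousComponent_isWeightedHomogeneous (w := Gen.degree) e p)
    split_ifs with h
    · subst h
      exact he.weightedHomogeneousComponent_same
    · exact he.weightedHomogeneousComponent_ne d (Ne.symm h)
  simp only [hc, Finset.sum_ite_eq']
  split_ifs with h
  · rfl
  · have h : weightedHomogeneousComponent Gen.degree d p = 0 := not_not.1 fun h' => h ((Set.Finite.mem_toFinset hfin).2 h')
    rw [h, map_zero]

theorem evalHom_dvd_of_isEdge {V : Set (SignedPerm n)} {w w' : V} {r : H2 n}
    (h : (rootGraph (rootsD n) V).IsEdge w w' r) (p : Poly n) :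
    r.toHBT ∣ evalHom w.1 p - evalHom w'.1 p := by
  obtain ⟨⟨a, b, u, ε, hab, hr⟩, hτ⟩ := isEdge_label h
  refine dvd_aeval_sub_aeval (fun g => ?_) p
  cases g with
  | tau i => exact hτ i
  | t i => simp [evalGen]
  | f l _ _ =>
    -- Twice f_l satisfies the edge condition; the 2 can be cancelled because the root is a prime
    -- not dividing it.
    have h1 : r.toHBT ∣ 2 * (halfDiff w.1 l - halfDiff w'.1 l) := by
      rw [mul_sub, two_mul_halfDiff, two_mul_halfDiff, sub_sub_sub_cancel_right]
      exact dvd_aeval_sub_aeval hτ _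
    have hu : IsUnit (C (u : ℤ) : HBT n) := u.isUnit.map C
    rw [hr, hu.mul_left_dvd] at h1 ⊢
    exact rootForm_dvd_of_dvd_two_mul hab ε h1

/-- Modulo a prime that divides no root, the generators separate the vertices. -/
theorem exists_not_dvd_evalGen_sub {π : HBT n} (hπ : Prime π)
    (hroot : ∀ (a b : Fin n) (ε : ℤˣ), a ≠ b → ¬ π ∣ rootForm a b ε) {w w' : SignedPerm n}
    (hsign : ∏ i, w.sign i = ∏ i, w'.sign i) (hw : w ≠ w') :
    ∃ g, ¬ π ∣ evalGen w g - evalGen w' g := by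
  by_contra! hcon
  have hτ : ∀ i, π ∣ (w.tAt i).toHBT - (w'.tAt i).toHBT := fun i => hcon (Gen.tau i)
  have hunit : ∀ u : ℤˣ, IsUnit (C (u : ℤ) : HBT n) := fun u => u.isUnit.map C
  have hperm : w'.perm = w.perm := by
    ext1 i
    by_contra hne
    have h1 := hτ i
    have h2 : (w.tAt i).toHBT - (w'.tAt i).toHBT =
        C (w.sign i : ℤ) * rootForm (w.perm i) (w'.perm i) (w.sign i * w'.sign i) := by
      rw [toHBT_tAt, toHBT_tAt, rootForm]
      rcases Int.units_eq_one_or (w.sign i) with h | h <;> simp [h]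
      ring
    rw [h2, (hunit _).dvd_mul_left] at h1
    exact hroot _ _ _ (Ne.symm hne) h1
  have hne : w.sign ≠ w'.sign := fun h => hw (SignedPerm.ext hperm.symm h)
  obtain ⟨i, hi⟩ := Function.ne_iff.1 hne
  -- Equal sign products force a second discrepancy. If π did not divide 2, it would divide two
  -- distinct variables.
  obtain ⟨j, hji, hj⟩ : ∃ j, j ≠ i ∧ w.sign j ≠ w'.sign j := by
    by_contra! hall
    rw [← Finset.mul_prod_erase _ _ (Finset.mem_univ i),
      ← Finset.mul_prod_erase _ w'.sign (Finset.mem_univ i),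
      Finset.prod_congr rfl fun j hj => hall j (Finset.ne_of_mem_erase hj)] at hsign
    exact hi (mul_right_cancel hsign)
  have htwo : ∀ k, w.sign k ≠ w'.sign k → π ∣ 2 ∨ π ∣ X (w.perm k) := by
    intro k hk
    have h1 := hτ k
    have h2 : (w.tAt k).toHBT - (w'.tAt k).toHBT = C (w.sign k : ℤ) * (2 * X (w.perm k)) := by
      rw [toHBT_tAt, toHBT_tAt, hperm]
      rcases Int.units_eq_one_or (w.sign k) with h | h <;>
        rcases Int.units_eq_one_or (w'.sign k) with h' | h'
      · exact absurd (h.trans h'.symm) hk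
      · simp [h, h']; ring
      · simp [h, h']; ring
      · exact absurd (h.trans h'.symm) hk
    rw [h2, (hunit _).dvd_mul_left] at h1
    exact hπ.dvd_or_dvd h1
  have hπ2 : π ∣ 2 := by
    rcases htwo i hi with h | h
    · exact h
    rcases htwo j hj with h' | h'
    · exact h'
    exfalso
    have h3 := ((hπ.dvd_prime_iff_associated X_prime).1 h).symm.dvd.trans h'
    rw [X_dvd_X] at h3
    exact hji (w.perm.injective h3).symm
  have h2 : Prime (C 2 : HBT n) := (prime_C_iff _).2 Int.prime_two
  have h2π : (C 2 : HBT n) ∣ π :=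
    ((hπ.dvd_prime_iff_associated h2).1 hπ2).symm.dvd
  have hn : 1 < n := by
    have := Fin.val_ne_of_ne hji
    omega
  obtain ⟨q, hq⟩ := h2π.trans (hcon (Gen.f 1 one_pos hn))
  -- At the prime 2 the difference of f_1 is a sum of ± variables over the positions with different
  -- signs: if it were 2q, the coefficient ±2 at position i would be divisible by 4.
  have h4 : C 4 * q = ∑ k, C ((w.sign k : ℤ) - w'.sign k) * X (w.perm k) := by
    have e1 := two_mul_halfDiff w 1
    have e2 := two_mul_halfDiff w' 1
    rw [esymm_one, map_sum] at e1 e2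
    have hq' : halfDiff w 1 - halfDiff w' 1 = C 2 * q := hq
    have e4 : (C 4 : HBT n) = 2 * C 2 := by
      rw [show (4 : ℤ) = 2 * 2 by norm_num, C_mul]
      rfl
    rw [e4, mul_assoc, ← hq', mul_sub, e1, e2, sub_sub_sub_cancel_right,
      ← Finset.sum_sub_distrib]
    refine Finset.sum_congr rfl fun k _ => ?_
    rw [aeval_X, aeval_X, toHBT_tAt, toHBT_tAt, hperm, C_sub, sub_mul]
  have h5 := congrArg (coeff (Finsupp.single (w.perm i) 1)) h4
  rw [coeff_C_mul, coeff_sum, Finset.sum_eq_single i] at h5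
  · rw [coeff_C_mul, coeff_X, if_pos rfl, mul_one] at h5
    rcases Int.units_eq_one_or (w.sign i) with h | h <;>
      rcases Int.units_eq_one_or (w'.sign i) with h' | h'
    · exact hi (h.trans h'.symm)
    · rw [h, h'] at h5
      norm_num at h5
      omega
    · rw [h, h'] at h5
      norm_num at h5
      omega
    · exact hi (h.trans h'.symm)
  · intro k _ hk
    rw [coeff_C_mul, coeff_X, if_neg, mul_zero]
    rw [Finsupp.single_left_inj one_ne_zero]
    exact fun e => hk (w.perm.injective e)
  · simp

/-! ### The relations -/

/-- The conventions for `F l`, `l ∈ ℕ`, on the component where `e_n(τ) = δ e_n(t)`: the generator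
`f_l` for `0 < l < n`, the polynomial `(δ - 1) / 2 * e_n(t)` for `l = n`, and `0` otherwise. -/
structure IsHalfFamily (δ : ℤˣ) (F : ℕ → Poly n) : Prop where
  zero : F 0 = 0
  eq_X : ∀ l (h0 : 0 < l) (h1 : l < n), F l = X (Gen.f l h0 h1)
  top : ∃ c : HBT n, F n = rename Gen.t c ∧ 2 * c = (C (δ : ℤ) - 1) * esymm (Fin n) ℤ n
  eq_zero_of_lt : ∀ l, n < l → F l = 0

/-- The ideal of relations on the component where `e_n(τ) = δ e_n(t)`. -/
noncomputable def relIdeal (δ : ℤˣ) (F : ℕ → Poly n) : Ideal (Poly n) :=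
  Ideal.span
    ({p | ∃ i, 1 ≤ i ∧ i < n ∧ p = 2 * F i - eTau n i + eT n i} ∪
      {p | ∃ k, 1 ≤ k ∧ k ≤ n ∧ p = quadRel F k} ∪
      {eTau n n - C (δ : ℤ) * eT n n})

variable {δ : ℤˣ} {F : ℕ → Poly n}

theorem evalHom_eTau_card (w : SignedPerm n) :
    evalHom w (eTau n n) = C ((∏ i, w.sign i : ℤˣ) : ℤ) * esymm (Fin n) ℤ n := by
  have h := aeval_esymm_card (fun i => (X i : HBT n))
  rw [aeval_X_left_apply] at h
  rw [evalHom_eTau, aeval_esymm_card, h, ← Equiv.prod_comp w.perm (fun i => (X i : HBT n))]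
  simp only [toHBT_tAt, Finset.prod_mul_distrib]
  rw [Units.coe_prod, map_prod]

/-- The boundary conventions are those for which 2 F_l = e_l(τ) - e_l(t) holds for every l; at l = n
this reads (δ - 1) e_n(t), which explains f_n = -e_n(t) on the odd component. -/
theorem IsHalfFamily.two_mul_evalHom (hF : IsHalfFamily δ F) {w : SignedPerm n}
    (hw : ∏ i, w.sign i = δ) (l : ℕ) :
    2 * evalHom w (F l) = evalHom w (eTau n l) - evalHom w (eT n l) := by
  rcases Nat.eq_zero_or_pos l with rfl | h0
  · simp [hF.zero, evalHom_eTau, evalHom_eT]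
  rcases lt_trichotomy l n with h1 | rfl | h1
  · rw [hF.eq_X l h0 h1, evalHom_eTau, evalHom_eT, ← two_mul_halfDiff, evalHom, aeval_X]
    rfl
  · obtain ⟨c, hc, hc'⟩ := hF.top
    rw [hc, evalHom_rename_t, hc', evalHom_eTau_card, hw, evalHom_eT]
    ring
  · simp [hF.eq_zero_of_lt l h1, evalHom_eTau, evalHom_eT, esymm_eq_zero_of_lt h1]

theorem IsHalfFamily.evalHom_quadRel (hF : IsHalfFamily δ F) {w : SignedPerm n}
    (hw : ∏ i, w.sign i = δ) (k : ℕ) : evalHom w (quadRel F k) = 0 := by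
  have h := sum_half_mul_eq_zero (E := fun l => evalHom w (eTau n l))
    (e := fun l => evalHom w (eT n l)) (F := fun l => evalHom w (F l)) (k := k)
    (by simp [hF.zero]) (hF.two_mul_evalHom hw) (by
      have := sum_esymm_mul_esymm (fun i => (w.tAt i).toHBT) X w.perm (fun i => by
        rw [toHBT_tAt, mul_pow, ← C_pow, ← Units.val_pow_eq_pow_val, Int.units_sq]
        simp) (2 * k)
      simpa only [evalHom_eTau, evalHom_eT, aeval_X_left_apply] using this)
  rw [quadRel, map_sum]
  simpa using h

theorem IsHalfFamily.evalHom_eq_zero (hF : IsHalfFamily δ F) {w : SignedPerm n}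
    (hw : ∏ i, w.sign i = δ) {p : Poly n} (hp : p ∈ relIdeal δ F) : evalHom w p = 0 := by
  have : relIdeal δ F ≤ RingHom.ker (evalHom w) := by
    refine Ideal.span_le.2 ?_
    rintro p ((⟨i, _, _, rfl⟩ | ⟨k, _, _, rfl⟩) | hp)
    · change evalHom w _ = 0
      rw [map_add, map_sub, map_mul, map_ofNat, hF.two_mul_evalHom hw]
      ring
    · exact hF.evalHom_quadRel hw k
    · rw [Set.mem_singleton_iff.1 hp]
      change evalHom w _ = 0
      rw [map_sub, map_mul, evalHom_eTau_card, hw, evalHom_eT]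
      simp
  exact this hp

end Evaluation

end GKM

namespace GKM

/-! ### The presentation -/

section Presentation

open MvPolynomial

variable {n : ℕ}

theorem finite_signedPerm : Finite (SignedPerm n) :=
  Finite.of_injective (fun w : SignedPerm n => (w.perm, w.sign)) fun w w' h => by
    simp only [Prod.mk.injEq] at h
    exact SignedPerm.ext h.1 h.2

theorem le_card_of_prod_sign {δ : ℤˣ} (hδ : n = 0 → δ = 1) {V : Set (SignedPerm n)}
    (hV : ∀ w, w ∈ V ↔ ∏ i, w.sign i = δ) : 2 ^ (n - 1) * n.factorial ≤ Nat.card V := by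
  have := finite_signedPerm (n := n)
  cases n with
  -- With truncated subtraction the bound is 1 here; the empty product of signs is 1, so δ = 1 is
  -- needed for V to be nonempty.
  | zero =>
    have : Nonempty V := ⟨⟨1, 1⟩, (hV _).2 (by simp [hδ rfl])⟩
    exact Nat.succ_le_of_lt (Nat.card_pos (α := V))
  | succ m =>
    -- The permutation and all signs but the first are free; the first sign is then fixed by δ.
    let f : (Fin m → ℤˣ) × Equiv.Perm (Fin (m + 1)) → V := fun x =>
      ⟨⟨x.2, Fin.cons (δ * ∏ i, x.1 i) x.1⟩, (hV _).2 (by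
        rw [Fin.prod_univ_succ]
        simp [mul_assoc, Int.units_mul_self])⟩
    have hf : Function.Injective f := by
      intro x y h
      have h1 := congrArg (fun v : V => v.1.perm) h
      have h2 := congrArg (fun v : V => v.1.sign) h
      exact Prod.ext (funext fun i => by simpa [f] using congrFun h2 i.succ) h1
    have := Nat.card_le_card_of_injective f hf
    rw [Nat.card_prod, Nat.card_perm, Nat.card_fun] at this
    simpa using this

/-- `ℤ[τ, t, f]` as an algebra over `ℤ[t]`. -/
noncomputable abbrev polyAlgebra (n : ℕ) : Algebra (HBT n) (Poly n) :=
  (rename Gen.t : HBT n →ₐ[ℤ] Poly n).toRingHom.toAlgebra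

attribute [local instance] polyAlgebra

variable {δ : ℤˣ} {F : ℕ → Poly n}

theorem IsHalfFamily.exists_generators (hF : IsHalfFamily δ F) :
    ∃ T : Finset (Poly n ⧸ relIdeal δ F), T.card ≤ 2 ^ (n - 1) * n.factorial ∧
      Submodule.span (HBT n) (T : Set (Poly n ⧸ relIdeal δ F)) = ⊤ := by
  set q := Ideal.Quotient.mk (relIdeal δ F) with hq
  have halg : ∀ r : HBT n, q (rename Gen.t r) = algebraMap (HBT n) _ r := fun r => rfl
  have hrel : ∀ p ∈ relIdeal δ F, q p = 0 := fun p hp => Ideal.Quotient.eq_zero_iff_mem.2 hp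
  have heTau : ∀ l, q (eTau n l) =
      (Finset.univ.val.map fun i => q (X (Gen.tau i))).esymm l := by
    intro l
    rw [Finset.esymm_map_val]
    simp [eTau, esymm]
  refine GKM.exists_generators (fun l => q (F l)) (fun l => esymm (Fin n) ℤ l)
    (fun i => q (X (Gen.tau i))) ?_ ?_ ?_ ?_
  · intro l hl
    rcases Nat.eq_zero_or_pos l with rfl | h0
    · exact ⟨0, by rw [hF.zero, map_zero, map_zero]⟩
    rcases (not_lt.1 fun h => hl ⟨h0, h⟩).eq_or_lt with rfl | h1
    · obtain ⟨c, hc, _⟩ := hF.top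
      exact ⟨c, by rw [hc, halg]⟩
    · exact ⟨0, by rw [hF.eq_zero_of_lt l h1, map_zero, map_zero]⟩
  · intro k h1 h2
    have := hrel (quadRel F k) (Ideal.subset_span (Or.inl (Or.inr ⟨k, h1, h2, rfl⟩)))
    rw [quadRel, map_sum] at this
    rw [← this]
    refine Finset.sum_congr rfl fun j _ => ?_
    rw [← halg]
    simp [eT]
  · intro l
    rw [← heTau]
    set B := Algebra.adjoin (HBT n) (Set.range fun l => q (F l))
    have heT : ∀ l, q (eT n l) ∈ B := fun l => B.algebraMap_mem (esymm (Fin n) ℤ l)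
    rcases Nat.eq_zero_or_pos l with rfl | h0
    · rw [eTau, esymm_zero, map_one, map_one]
      exact B.one_mem
    rcases lt_trichotomy l n with h1 | rfl | h1
    · have := hrel _ (Ideal.subset_span (Or.inl (Or.inl ⟨l, h0, h1, rfl⟩)))
      rw [map_add, map_sub, map_mul, map_ofNat, sub_add, sub_eq_zero] at this
      rw [show q (eTau n l) = 2 * q (F l) + q (eT n l) by rw [this]; ring, two_mul]
      have hFB : q (F l) ∈ B := Algebra.subset_adjoin ⟨l, rfl⟩
      exact B.add_mem (B.add_mem hFB hFB) (heT l)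
    · have := hrel _ (Ideal.subset_span (Or.inr rfl))
      rw [map_sub, map_mul, sub_eq_zero] at this
      rw [this]
      refine B.mul_mem ?_ (heT l)
      have h := B.algebraMap_mem (C (δ : ℤ))
      rwa [← halg, rename_C] at h
    · rw [eTau, esymm_eq_zero_of_lt h1, map_zero, map_zero]
      exact B.zero_mem
  · rw [eq_top_iff]
    rintro x -
    obtain ⟨p, rfl⟩ := Ideal.Quotient.mk_surjective x
    set B := Algebra.adjoin (HBT n)
      ((Set.range fun l => q (F l)) ∪ Set.range fun i => q (X (Gen.tau i)))
    induction p using MvPolynomial.induction_on with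
    | C r =>
      have h := B.algebraMap_mem (C r)
      rwa [← halg, rename_C] at h
    | add p p' hp hp' =>
      rw [map_add]
      exact B.add_mem hp hp'
    | mul_X p g hp =>
      rw [map_mul]
      refine B.mul_mem hp ?_
      cases g with
      | tau i => exact Algebra.subset_adjoin (Or.inr ⟨i, rfl⟩)
      | t i =>
        have h := B.algebraMap_mem (X i)
        rwa [← halg, rename_X] at h
      | f l h0 h1 =>
        rw [← hF.eq_X l h0 h1]
        exact Algebra.subset_adjoin (Or.inl ⟨l, rfl⟩)

/-- Evaluation of polynomials in the generators at the vertices. -/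
noncomputable def evalVertices (V : Set (SignedPerm n)) : Poly n →ₐ[HBT n] (V → HBT n) where
  toRingHom := RingHom.pi fun w => (evalHom w.1).toRingHom
  commutes' r := by
    ext1 w
    exact evalHom_rename_t w.1 r

variable {V : Set (SignedPerm n)}

/-- The cohomology classes are locally, at each prime of `ℤ[t]`, polynomials in the generators. -/
theorem exists_smul_mem_range (hV : ∀ w, w ∈ V ↔ ∏ i, w.sign i = δ) {h : V → HBT n}
    (hh : h ∈ (rootGraph (rootsD n) V).cohomology) {π : HBT n} (hπ : Prime π) :
    ∃ s, ¬ π ∣ s ∧ s • h ∈ (evalVertices V).range := by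
  classical
  have := finite_signedPerm (n := n)
  have := Fintype.ofFinite V
  by_cases hroot : ∀ (a b : Fin n) (ε : ℤˣ), a ≠ b → ¬ π ∣ rootForm a b ε
  · refine exists_smul_mem_of_separated hπ (fun w w' hw => ?_) h
    obtain ⟨g, hg⟩ := exists_not_dvd_evalGen_sub hπ hroot
      (((hV _).1 w.2).trans ((hV _).1 w'.2).symm) (fun e => hw (Subtype.ext e))
    refine ⟨evalVertices V (X g), ⟨_, rfl⟩, ?_⟩
    change ¬ π ∣ evalHom w.1 (X g) - evalHom w'.1 (X g)
    rwa [evalHom, evalHom, aeval_X, aeval_X]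
  · push Not at hroot
    obtain ⟨a, b, ε, hab, hdvd⟩ := hroot
    have hα := prime_rootForm hab ε
    have hass := (hπ.dvd_prime_iff_associated hα).1 hdvd
    have hmem : ∀ w : V, w.1.reflect a b ε ∈ V := fun w =>
      (hV _).2 ((prod_sign_reflect hab ε w.1).trans ((hV _).1 w.2))
    have hinv : Function.Involutive fun w : V => (⟨w.1.reflect a b ε, hmem w⟩ : V) := fun w =>
      Subtype.ext (reflect_reflect a b ε w.1)
    have hedge := fun w : V =>
      exists_isEdge_reflect w ⟨w.1.reflect a b ε, hmem w⟩ hab ε rfl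
    obtain ⟨s, hs, hsL⟩ := exists_smul_mem_of_paired (L := (evalVertices V).range) hα
      (not_rootForm_dvd_two hab ε) (hinv.toPerm _) hinv
      (fun w e => reflect_ne hab ε w.1 (congrArg Subtype.val e))
      (fun w w' h1 h2 => by
        by_contra! hcon
        have h3 := eq_or_eq_reflect hab ε w.1 w'.1 fun i => by
          have := hcon (evalVertices V (X (Gen.tau i))) ⟨_, rfl⟩
          change _ ∣ evalHom w.1 (X _) - evalHom w'.1 (X _) at this
          rwa [evalHom, evalHom, aeval_X, aeval_X] at this
        rcases h3 with h3 | h3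
        · exact h1 (Subtype.ext h3)
        · exact h2 (Subtype.ext h3))
      (by
        rintro _ ⟨p, rfl⟩ w
        obtain ⟨r, hr, hr'⟩ := hedge w
        rw [← hr']
        exact evalHom_dvd_of_isEdge hr p)
      (fun w => by
        obtain ⟨i, hi⟩ := toHBT_tAt_sub_reflect a b ε w.1
        refine ⟨evalVertices V (C (w.1.sign i : ℤ) * X (Gen.tau i)), ⟨_, rfl⟩, ?_⟩
        change evalHom w.1 _ - evalHom (w.1.reflect a b ε) _ = _
        rw [map_mul, map_mul, ← hi, evalHom, evalHom, aeval_X, aeval_X, mul_sub]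
        simp [evalGen])
      h (fun w => by
        obtain ⟨r, hr, hr'⟩ := hedge w
        rw [← hr']
        exact hh _ _ _ hr)
    exact ⟨s, fun hd => hs (hass.symm.dvd.trans hd), hsL⟩

theorem IsHalfFamily.exists_ringEquiv (hF : IsHalfFamily δ F) (hδ : n = 0 → δ = 1)
    (hV : ∀ w, w ∈ V ↔ ∏ i, w.sign i = δ) :
    ∃ Ψ : (Poly n ⧸ relIdeal δ F) ≃+* (rootGraph (rootsD n) V).cohomology,
      ∀ (p : Poly n) (w : V), (Ψ (Ideal.Quotient.mk _ p)).1 w = evalHom w.1 p := by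
  classical
  have := finite_signedPerm (n := n)
  have := Fintype.ofFinite V
  let Φ : (Poly n ⧸ relIdeal δ F) →ₐ[HBT n] (V → HBT n) :=
    Ideal.Quotient.liftₐ (relIdeal δ F) (evalVertices V) fun p hp => by
      ext1 w
      exact hF.evalHom_eq_zero ((hV _).1 w.2) hp
  have hΦ : ∀ p, Φ (Ideal.Quotient.mk _ p) = evalVertices V p := fun p => rfl
  obtain ⟨T, hT, hspan⟩ := hF.exists_generators
  obtain ⟨b, hb⟩ : ∃ b : V → Poly n ⧸ relIdeal δ F,
      Submodule.span (HBT n) (Set.range b) = ⊤ := by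
    have hle : Fintype.card T ≤ Fintype.card V := by
      rw [Fintype.card_coe, ← Nat.card_eq_fintype_card]
      exact hT.trans (le_card_of_prod_sign hδ hV)
    obtain ⟨ι⟩ := Function.Embedding.nonempty_of_card_le hle
    -- Padding the generators by zeros gives a family indexed by V, so the matrix is square.
    refine ⟨Function.extend ι Subtype.val 0, ?_⟩
    rw [eq_top_iff, ← hspan]
    refine Submodule.span_mono fun t ht => ⟨ι ⟨t, ht⟩, ?_⟩
    rw [ι.injective.extend_apply]
  -- For full rank any prime dividing no root will do, since the vertices are separated there.
  have h3 : Prime (C 3 : HBT n) := (prime_C_iff _).2 Int.prime_three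
  obtain ⟨hinj, hsurj⟩ := injective_and_mem_range_of_local Φ.toLinearMap b hb (fun w => by
    obtain ⟨d, hd, p, hp⟩ := exists_single_mem (L := (evalVertices V).range) h3
      (fun w w' hw => by
        obtain ⟨g, hg⟩ := exists_not_dvd_evalGen_sub h3
          (fun a b ε hab => not_three_dvd_rootForm hab ε)
          (((hV _).1 w.2).trans ((hV _).1 w'.2).symm) (fun e => hw (Subtype.ext e))
        refine ⟨evalVertices V (X g), ⟨_, rfl⟩, ?_⟩
        change ¬ _ ∣ evalHom w.1 (X g) - evalHom w'.1 (X g)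
        rwa [evalHom, evalHom, aeval_X, aeval_X]) w
    exact ⟨Ideal.Quotient.mk _ p, d, fun e => hd (e ▸ dvd_zero _), hp⟩)
  have hmem : ∀ a, Φ.toRingHom a ∈ (rootGraph (rootsD n) V).cohomology := by
    intro a
    obtain ⟨p, rfl⟩ := Ideal.Quotient.mk_surjective a
    exact fun w w' r hr => evalHom_dvd_of_isEdge hr p
  refine ⟨RingEquiv.ofBijective (Φ.toRingHom.codRestrict _ hmem) ⟨fun a a' haa => ?_, ?_⟩,
    fun p w => rfl⟩
  · exact hinj (congrArg Subtype.val haa)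
  · rintro ⟨h, hh⟩
    obtain ⟨a, ha⟩ := hsurj h fun π hπ => by
      obtain ⟨s, hs, p, hp⟩ := exists_smul_mem_range hV hh hπ
      exact ⟨s, hs, Ideal.Quotient.mk _ p, hp⟩
    exact ⟨a, Subtype.ext ha⟩

theorem IsHalfFamily.exists_graded_ringEquiv (hF : IsHalfFamily δ F) (hδ : n = 0 → δ = 1)
    (hV : ∀ w, w ∈ V ↔ ∏ i, w.sign i = δ) {I : Ideal (Poly n)} (hI : I = relIdeal δ F) :
    ∃ Ψ : (Poly n ⧸ I) ≃+* (rootGraph (rootsD n) V).cohomology,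
      (∀ (i : Fin n) (w : V),
        (Ψ (Ideal.Quotient.mk _ (X (Gen.tau i)))).1 w = (w.1.tAt i).toHBT) ∧
      (∀ (i : Fin n) (w : V), (Ψ (Ideal.Quotient.mk _ (X (Gen.t i)))).1 w = X i) ∧
      (∀ (l : ℕ) (h0 : 0 < l) (h1 : l < n) (w : V),
        2 * (Ψ (Ideal.Quotient.mk _ (X (Gen.f l h0 h1)))).1 w =
          aeval (fun i => (w.1.tAt i).toHBT) (esymm (Fin n) ℤ l) - esymm (Fin n) ℤ l) ∧
      (∀ (d : ℕ) (h : (rootGraph (rootsD n) V).cohomology),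
        (∀ w, IsWeightedHomogeneous (fun _ => 2) (h.1 w) d) ↔
          ∃ p : Poly n, IsWeightedHomogeneous Gen.degree p d ∧
            Ψ (Ideal.Quotient.mk _ p) = h) := by
  subst hI
  obtain ⟨Ψ, hΨ⟩ := hF.exists_ringEquiv hδ hV
  refine ⟨Ψ, fun i w => ?_, fun i w => ?_, fun l h0 h1 w => ?_, fun d h => ⟨fun hh => ?_, ?_⟩⟩
  · rw [hΨ, evalHom, aeval_X, evalGen]
  · rw [hΨ, evalHom, aeval_X, evalGen]
  · rw [hΨ, evalHom, aeval_X, evalGen, two_mul_halfDiff]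
  · obtain ⟨a, rfl⟩ := Ψ.surjective h
    obtain ⟨p, rfl⟩ := Ideal.Quotient.mk_surjective a
    -- Evaluation preserves degrees, so the degree d part of any preimage of a homogeneous class is
    -- again a preimage.
    refine ⟨weightedHomogeneousComponent Gen.degree d p,
      weightedHomogeneousComponent_isWeightedHomogeneous d p, Subtype.ext (funext fun (w : V) => ?_)⟩
    have h1 := hh w
    rw [hΨ] at h1
    rw [hΨ, hΨ, ← weightedHomogeneousComponent_evalHom]
    exact h1.weightedHomogeneousComponent_same
  · rintro ⟨p, hp, rfl⟩ (w : V)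
    rw [hΨ]
    exact isWeightedHomogeneous_evalHom w.1 hp

/-! ### The two components δ = 1 and δ = -1. -/

theorem isHalfFamily_fD (n : ℕ) : IsHalfFamily 1 (fD n) where
  zero := by simp [fD]
  eq_X l h0 h1 := by simp [fD, h0, h1]
  top := ⟨0, by simp [fD], by simp⟩
  eq_zero_of_lt l h := by simp [fD, h.le]

theorem isHalfFamily_fDMinus {n : ℕ} (hn : 1 ≤ n) : IsHalfFamily (-1) (fDMinus n) where
  zero := by
    -- For n = 0 the conventions at l = 0 and l = n would collide, with value -1 in place of 0.
    have : 0 ≠ n := by omega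
    simp [fDMinus, fD, this]
  eq_X l h0 h1 := by simp [fDMinus, fD, h0, h1, h1.ne]
  top := ⟨-esymm (Fin n) ℤ n, by simp [fDMinus, eT], by simp; ring⟩
  eq_zero_of_lt l h := by simp [fDMinus, fD, h.ne', h.le]

theorem prod_sign_eq (w : SignedPerm n) : ∏ i, w.sign i = (-1) ^ w.negCount := by
  rw [SignedPerm.negCount, ← Finset.prod_const, Finset.prod_filter]
  refine Finset.prod_congr rfl fun i _ => ?_
  rcases Int.units_eq_one_or (w.sign i) with h | h <;> simp [h]

theorem mem_evenSigned_iff (w : SignedPerm n) : w ∈ evenSigned n ↔ ∏ i, w.sign i = 1 := by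
  rw [prod_sign_eq, evenSigned, Set.mem_ofPred_eq, neg_one_pow_eq_one_iff_even (by decide)]

theorem mem_oddSigned_iff (w : SignedPerm n) : w ∈ oddSigned n ↔ ∏ i, w.sign i = -1 := by
  rw [prod_sign_eq, oddSigned, Set.mem_ofPred_eq, neg_one_pow_eq_neg_one_iff_odd (by decide)]

theorem idealD_eq (n : ℕ) : idealD n = relIdeal 1 (fD n) := by
  simp [idealD, relIdeal]

theorem idealDMinus_eq (n : ℕ) : idealDMinus n = relIdeal (-1) (fDMinus n) := by
  simp [idealDMinus, relIdeal]

end Presentation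

end GKM

theorem mainTheorem4 (n : ℕ) :
    -- the graph `D_n`
    (∃ Ψ : (GKM.Poly n ⧸ GKM.idealD n) ≃+* (GKM.graphD n).cohomology,
      -- `τ_i`, `t_i`, `f_i` go to the elements of these names
      (∀ (i : Fin n) (w : GKM.evenSigned n),
        (Ψ (Ideal.Quotient.mk _ (MvPolynomial.X (GKM.Gen.tau i)))).1 w = (w.1.tAt i).toHBT) ∧
      (∀ (i : Fin n) (w : GKM.evenSigned n),
        (Ψ (Ideal.Quotient.mk _ (MvPolynomial.X (GKM.Gen.t i)))).1 w = MvPolynomial.X i) ∧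
      (∀ (l : ℕ) (h0 : 0 < l) (h1 : l < n) (w : GKM.evenSigned n),
        2 * (Ψ (Ideal.Quotient.mk _ (MvPolynomial.X (GKM.Gen.f l h0 h1)))).1 w =
          MvPolynomial.aeval (fun i => (w.1.tAt i).toHBT) (MvPolynomial.esymm (Fin n) ℤ l) -
            MvPolynomial.esymm (Fin n) ℤ l) ∧
      -- and the isomorphism respects the gradings
      (∀ (d : ℕ) (h : (GKM.graphD n).cohomology),
        (∀ w, MvPolynomial.IsWeightedHomogeneous (fun _ => 2) (h.1 w) d) ↔
          ∃ p : GKM.Poly n, MvPolynomial.IsWeightedHomogeneous GKM.Gen.degree p d ∧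
            Ψ (Ideal.Quotient.mk _ p) = h)) ∧
    -- the companion graph `D_n^-`
    (1 ≤ n → ∃ Ψ : (GKM.Poly n ⧸ GKM.idealDMinus n) ≃+* (GKM.graphDMinus n).cohomology,
      (∀ (i : Fin n) (w : GKM.oddSigned n),
        (Ψ (Ideal.Quotient.mk _ (MvPolynomial.X (GKM.Gen.tau i)))).1 w = (w.1.tAt i).toHBT) ∧
      (∀ (i : Fin n) (w : GKM.oddSigned n),
        (Ψ (Ideal.Quotient.mk _ (MvPolynomial.X (GKM.Gen.t i)))).1 w = MvPolynomial.X i) ∧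
      (∀ (l : ℕ) (h0 : 0 < l) (h1 : l < n) (w : GKM.oddSigned n),
        2 * (Ψ (Ideal.Quotient.mk _ (MvPolynomial.X (GKM.Gen.f l h0 h1)))).1 w =
          MvPolynomial.aeval (fun i => (w.1.tAt i).toHBT) (MvPolynomial.esymm (Fin n) ℤ l) -
            MvPolynomial.esymm (Fin n) ℤ l) ∧
      (∀ (d : ℕ) (h : (GKM.graphDMinus n).cohomology),
        (∀ w, MvPolynomial.IsWeightedHomogeneous (fun _ => 2) (h.1 w) d) ↔
          ∃ p : GKM.Poly n, MvPolynomial.IsWeightedHomogeneous GKM.Gen.degree p d ∧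
            Ψ (Ideal.Quotient.mk _ p) = h)) := by
  exact ⟨(GKM.isHalfFamily_fD n).exists_graded_ringEquiv (fun _ => rfl) GKM.mem_evenSigned_iff
      (GKM.idealD_eq n),
    fun hn => (GKM.isHalfFamily_fDMinus hn).exists_graded_ringEquiv (by omega)
      GKM.mem_oddSigned_iff (GKM.idealDMinus_eq n)⟩
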